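/- Fix an integer $D\ge 2$, energies $E_0,\dots,E_D\in\mathbb R$ and $\beta\in\mathbb R$. For $N\ge1$ let $\mathbb T_N$ be the set of plane (rooted, ordered) trees on $N$ vertices in which every vertex $v$ has at most $D$ children, let $E(T)=\sum_{v\in T}E_{\deg(v)}$, where $\deg(v)$ is the number of children of $v$, and let $\mu_N$ be the probability measure on $\mathbb T_N$ with $\mu_N\{T\}=e^{-\beta E(T)}/Z_N$, $Z_N=\sum_{T\in\mathbb T_N}e^{-\beta E(T)}$. For a finite or infinite plane tree $T$ let $\pi_nT$ be the subtree formed by all its vertices at distance at most $n$ from the root. Let $\Delta$ be the set of $p\in[0,1]^{D+1}$ with $\sum_{i=0}^Dp_i=\sum_{i=0}^Dip_i=1$, let $J(p)=\sum_{i=0}^Dp_i\ln p_i+\beta\sum_{i=0}^Dp_iE_i$ (with $0\ln 0=0$), let $J^*=\min_\Delta J$ and $\sigma=e^{J^*}$, and let $\rho>0$ be the unique positive solution of $\sum_{i=0}^De^{-\beta E_i}\rho^i=\sum_{i=0}^Di\,e^{-\beta E_i}\rho^i$. There is a unique probability measure $P_\infty$ on the space of (finite or infinite) plane trees with branching numbers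 at most $D$ (with the $\sigma$-algebra generated by the finite neighborhoods of the root) such that for every $n\ge0$ the law of $\pi_nT$ under $\mu_N$ converges in total variation, as $N\to\infty$, to the law of $\pi_nT$ under $P_\infty$. Under $P_\infty$, the numbers $Y_n$ of vertices at distance $n$ from the root, $n=0,1,2,\dots$, form a time-homogeneous Markov chain with transition probabilities \[ \mathsf P\{Y_{n+1}=k'\mid Y_n=k\}=\frac{k'}{k}\,\rho^{k'-k}\sigma^{k}\sum_{\substack{0\le i_1,\dots,i_k\le D\\ i_1+\dots+i_k=k'}}e^{-\beta(E_{i_1}+\dots+E_{i_k})} \] for all $n,k'\ge0$ and all $k$ with $\mathsf P\{Y_n=k\}>0$. -/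

import Mathlib

open Filter Topology MeasureTheory ProbabilityTheory

noncomputable section

/-- A (finite or infinite) plane tree whose branching numbers do not exceed `D`, in Ulam-Harris
coding: the root is the empty word, and the children of the vertex `v` are, from left to right,
the vertices `v ++ [0]`, ..., `v ++ [d - 1]`, where `d ≤ D` is the branching number of `v`.
Every plane tree with branching bounded by `D` is coded by exactly one such set of words. -/
@[ext]
structure PlaneTree (D : ℕ) where
  /-- the set of vertices -/
  verts : Set (List (Fin D))
  root_mem : [] ∈ verts
  prefix_mem : ∀ u v : List (Fin D), u <+: v → v ∈ verts → u ∈ verts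
  left_mem : ∀ (v : List (Fin D)) (i j : Fin D), j ≤ i → v ++ [i] ∈ verts → v ++ [j] ∈ verts

namespace PlaneTree

variable {D : ℕ}

/-- The σ-algebra on the space of trees generated by the events `v ∈ T`, `v` a word. -/
instance : MeasurableSpace (PlaneTree D) := MeasurableSpace.comap PlaneTree.verts inferInstance

open Classical in
/-- The branching number (number of children) of the vertex `v`. -/
def deg (T : PlaneTree D) (v : List (Fin D)) : Fin (D + 1) :=
  ⟨(Finset.univ.filter fun i : Fin D => v ++ [i] ∈ T.verts).card,
    Nat.lt_succ_of_le ((Finset.card_le_univ _).trans_eq (Fintype.card_fin D))⟩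

/-- The energy of a finite tree: the sum over its vertices of `E (deg v)`. -/
def energy (E : Fin (D + 1) → ℝ) (T : PlaneTree D) : ℝ :=
  ∑ᶠ v ∈ T.verts, E (T.deg v)

/-- The neighbourhood of the root of radius `n`: all vertices of height at most `n`. -/
def trunc (n : ℕ) (T : PlaneTree D) : PlaneTree D where
  verts := {v | v ∈ T.verts ∧ v.length ≤ n}
  root_mem := ⟨T.root_mem, Nat.zero_le n⟩
  prefix_mem u v huv hv := ⟨T.prefix_mem u v huv hv.1, huv.length_le.trans hv.2⟩
  left_mem v i j hji hv := ⟨T.left_mem v i j hji hv.1, by simpa using hv.2⟩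

/-- The number of vertices of height `n`. -/
def levelSize (n : ℕ) (T : PlaneTree D) : ℕ :=
  {v | v ∈ T.verts ∧ v.length = n}.ncard

/-- The set of plane trees on `N` vertices with branching bounded by `D`. -/
def ofSize (D N : ℕ) : Set (PlaneTree D) := {T | T.verts.encard = N}

theorem finite_ofSize (D N : ℕ) : (ofSize D N).Finite := by
  have hfin : {v : List (Fin D) | v.length < N}.Finite := List.finite_length_lt (Fin D) N
  refine Set.Finite.of_finite_image (f := PlaneTree.verts) (hfin.finite_subsets.subset ?_)
    (fun T _ T' _ h => PlaneTree.ext h)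
  rintro _ ⟨T, hT, rfl⟩ v hv
  have hT' : T.verts.encard = N := hT
  have hsub : ((Finset.range (v.length + 1)).image fun m => v.take m : Set (List (Fin D)))
      ⊆ T.verts := by
    intro u hu
    simp only [Finset.coe_image, Set.mem_image] at hu
    obtain ⟨m, -, rfl⟩ := hu
    exact T.prefix_mem _ _ (List.take_prefix m v) hv
  have hcard : ((Finset.range (v.length + 1)).image fun m => v.take m).card = v.length + 1 := by
    rw [Finset.card_image_of_injOn, Finset.card_range]
    intro a ha b hb hab
    simp only [Finset.coe_range, Set.mem_Iio] at ha hb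
    have := congrArg List.length hab
    simp only [List.length_take] at this
    omega
  have h := Set.encard_le_encard hsub
  rw [Set.encard_coe_eq_coe_finsetCard, hcard, hT'] at h
  have h' : v.length + 1 ≤ N := by exact_mod_cast h
  exact h'

open Classical in
/-- The probability of the event `A` under the Gibbs distribution at inverse temperature `β`
on the plane trees on `N` vertices, which gives to `T` the weight `exp (-β E(T)) / Z_N`. -/
def gibbsProb (E : Fin (D + 1) → ℝ) (β : ℝ) (N : ℕ) (A : Set (PlaneTree D)) : ℝ :=
  (∑ T ∈ (finite_ofSize D N).toFinset with T ∈ A, Real.exp (-β * T.energy E)) /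
    ∑ T ∈ (finite_ofSize D N).toFinset, Real.exp (-β * T.energy E)

/-- `P` is the law of the limiting random tree: a probability measure on the space of (finite or
infinite) plane trees such that for every `n` the law of the neighbourhood of the root of radius
`n` under the Gibbs distribution on trees with `N` vertices converges, as `N → ∞`, to its law
under `P`. As there are only finitely many trees of height at most `n`, convergence of the
probability of every tree `τ` is convergence in total variation. -/
def IsThermodynamicLimit (E : Fin (D + 1) → ℝ) (β : ℝ) (P : Measure (PlaneTree D)) : Prop :=
  IsProbabilityMeasure P ∧
    ∀ (n : ℕ) (τ : PlaneTree D),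
      Tendsto (fun N : ℕ => gibbsProb E β N {T | T.trunc n = τ}) atTop
        (𝓝 (P.real {T | T.trunc n = τ}))

end PlaneTree

/-- Probability vectors on `{0, ..., D}` with mean one. -/
def criticalVectors (D : ℕ) : Set (Fin (D + 1) → ℝ) :=
  {p | (∀ i, p i ∈ Set.Icc (0 : ℝ) 1) ∧ ∑ i, p i = 1 ∧ ∑ i : Fin (D + 1), ((i : ℕ) : ℝ) * p i = 1}

/-- The free energy `J(p) = -H(p) + β E(p)`, with `H(p) = -∑ p_i log p_i` the entropy
(`0 log 0 = 0`) and `E(p) = ∑ p_i E_i` the energy of the vector `p`. -/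
def freeEnergy {D : ℕ} (E : Fin (D + 1) → ℝ) (β : ℝ) (p : Fin (D + 1) → ℝ) : ℝ :=
  -(-∑ i, p i * Real.log (p i)) + β * ∑ i, p i * E i

/-- The number
`(k' / k) ρ^(k' - k) σ^k ∑ exp (-β (E_{i_1} + ... + E_{i_k}))`,
the sum being over all `0 ≤ i_1, ..., i_k ≤ D` with `i_1 + ... + i_k = k'`. -/
def levelTransition {D : ℕ} (E : Fin (D + 1) → ℝ) (β ρ σ : ℝ) (k k' : ℕ) : ℝ :=
  (k' : ℝ) / (k : ℝ) * ρ ^ ((k' : ℤ) - (k : ℤ)) * σ ^ k *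
    ∑ i : Fin k → Fin (D + 1) with ∑ j, (i j : ℕ) = k', Real.exp (-β * ∑ j, E (i j))

/-- The `ℕ`-valued process `Y` is a time-homogeneous Markov chain under `P` with transition
probabilities `q`: for all `n`, the conditional probability of `Y (n + 1) = k'` is `q (Y n) k'`,
both given the whole past `Y 0, ..., Y n` and given `Y n` alone, whenever the event that one
conditions on has positive probability. -/
def IsMarkovChainWith {Ω : Type*} [MeasurableSpace Ω] (P : Measure Ω) (Y : ℕ → Ω → ℕ)
    (q : ℕ → ℕ → ℝ) : Prop :=
  (∀ n, Measurable (Y n)) ∧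
  (∀ (n : ℕ) (y : ℕ → ℕ), P {ω | ∀ i ≤ n, Y i ω = y i} ≠ 0 →
    ∀ k' : ℕ, (P[|{ω | ∀ i ≤ n, Y i ω = y i}]).real {ω | Y (n + 1) ω = k'} = q (y n) k') ∧
  (∀ (n k : ℕ), P {ω | Y n ω = k} ≠ 0 →
    ∀ k' : ℕ, (P[|{ω | Y n ω = k}]).real {ω | Y (n + 1) ω = k'} = q k k')

end

/-! Write w_i = exp(-βE_i), f(x) = ∑ w_i x^i and F = f(ρ). Explore a tree vertex by vertex. The
trees on N vertices with prescribed branching numbers on a finite set S have total weight ∏_S w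
times the weight of the ordered forests on N - |S| vertices, with one tree for every vertex
discovered but not yet explored (`partitionSum_cylinder`). The empty S gives Z_N.

Forest weights have explicit asymptotics. By the Otter-Dwass formula (`mul_forestWeight`), forests
of k trees on M vertices weigh (k/M)·[x^(M-k)] f^M. The equation for ρ says that the tilted vector
q_i = w_i ρ^i / F, a probability vector, has mean one. The local limit theorem for q
(`exists_tendsto_sqrt_mul_coeff`) then shows that this weight, times M^(3/2) (ρ/F)^M, tends to
c·k·ρ^k with c > 0 not depending on k. Dividing by Z_N, the probability of a cylinder with k
unexplored vertices tends to k ρ^(k-1) (ρ/F)^|S| ∏_S w. Nonnegativity of relative entropy shows that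
q minimizes the free energy, so ρ/F = σ (`exp_freeEnergy_eq`).

A limiting measure exists because trees are coded by points of a compact space in which
neighbourhood events are clopen. It is unique because these events generate the σ-algebra through a
π-system. For the Markov property, compare the limiting probabilities of a radius-n neighbourhood
before and after the branching numbers at level n are revealed: their ratio depends on the
neighbourhood only through its number of vertices at level n (`measureReal_trunc_inter_levelSize`).
-/

/-! ### Forest weights and the Otter-Dwass formula. -/

/-- The generating polynomial of a weight sequence. -/
noncomputable def offspringPoly {D : ℕ} (w : Fin (D + 1) → ℝ) : Polynomial ℝ :=
  ∑ i, Polynomial.C (w i) * Polynomial.X ^ (i : ℕ)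

/-- The total weight of the ordered forests of `k` plane trees with `M` vertices altogether, a
vertex with `i` children having weight `w i`. The recursion removes the root of the first tree. -/
def forestWeight {D : ℕ} (w : Fin (D + 1) → ℝ) : ℕ → ℕ → ℝ
  | 0, k => if k = 0 then 1 else 0
  | _ + 1, 0 => 0
  | M + 1, k + 1 => ∑ i, w i * forestWeight w M (k + i)

theorem forestWeight_eq_zero_of_lt {D : ℕ} (w : Fin (D + 1) → ℝ) {M k : ℕ} (h : M < k) :
    forestWeight w M k = 0 := by
  induction M generalizing k with
  | zero => simp [forestWeight]; omega
  | succ M ih =>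
    obtain ⟨k, rfl⟩ : ∃ l, k = l + 1 := ⟨k - 1, by omega⟩
    simp only [forestWeight]
    exact Finset.sum_eq_zero fun i _ => by rw [ih (by omega), mul_zero]

open Polynomial in
theorem coeff_offspringPoly_mul {D : ℕ} (w : Fin (D + 1) → ℝ) (q : ℝ[X]) (n : ℕ) :
    (offspringPoly w * q).coeff n =
      ∑ i : Fin (D + 1), if (i : ℕ) ≤ n then w i * q.coeff (n - i) else 0 := by
  simp only [offspringPoly, Finset.sum_mul, Polynomial.finsetSum_coeff, mul_assoc,
    Polynomial.coeff_C_mul, Polynomial.coeff_X_pow_mul', mul_ite, mul_zero]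

open Polynomial in
-- The operator X·d/dX multiplies the i-th weight by i. This handles the part of the Otter-Dwass
-- induction in which the number of trees grows by i.
theorem coeff_X_mul_derivative_offspringPoly_mul {D : ℕ} (w : Fin (D + 1) → ℝ) (q : ℝ[X]) (n : ℕ) :
    (X * derivative (offspringPoly w) * q).coeff n =
      ∑ i : Fin (D + 1), if (i : ℕ) ≤ n then i * w i * q.coeff (n - i) else 0 := by
  have h : X * derivative (offspringPoly w) = offspringPoly fun i => (i : ℕ) * w i := by
    simp only [offspringPoly, derivative_sum, Finset.mul_sum, derivative_C_mul_X_pow]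
    refine Finset.sum_congr rfl fun i _ => ?_
    rcases Nat.eq_zero_or_pos (i : ℕ) with h | h
    · simp [h]
    · obtain ⟨m, hm⟩ : ∃ m, (i : ℕ) = m + 1 := ⟨i - 1, by omega⟩
      rw [hm]
      simp only [Nat.add_sub_cancel, map_mul, map_natCast]
      ring
  rw [h, coeff_offspringPoly_mul]

open Polynomial in
/-- The Otter-Dwass formula. -/
theorem mul_forestWeight {D : ℕ} (w : Fin (D + 1) → ℝ) {M k : ℕ} (hM : 0 < M) (h : k ≤ M) :
    M * forestWeight w M k = k * (offspringPoly w ^ M).coeff (M - k) := by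
  obtain ⟨M, rfl⟩ : ∃ l, M = l + 1 := ⟨M - 1, by omega⟩
  clear hM
  induction M generalizing k with
  | zero =>
    interval_cases k
    · simp [forestWeight]
    · have := coeff_offspringPoly_mul w 1 0
      simp only [mul_one] at this
      simp only [forestWeight, zero_add, pow_one, Nat.sub_self, this]
      simp
  | succ M ih =>
    rcases Nat.eq_zero_or_pos k with rfl | hk
    · simp [forestWeight]
    obtain ⟨k, rfl⟩ : ∃ l, k = l + 1 := ⟨k - 1, by omega⟩
    simp only [forestWeight]
    set f := offspringPoly w
    have e1 := coeff_offspringPoly_mul w (f ^ (M + 1)) (M + 1 - k)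
    have e2 := coeff_X_mul_derivative_offspringPoly_mul w (f ^ (M + 1)) (M + 1 - k)
    -- Compare coefficients in X·(f^(M+2))' = (M+2)·X·f'·f^(M+1).
    have e3 : ((M : ℝ) + 2) * (X * derivative f * f ^ (M + 1)).coeff (M + 1 - k) =
        ((M : ℝ) + 1 - k) * (f ^ (M + 2)).coeff (M + 1 - k) := by
      have h1 : X * derivative (f ^ (M + 2)) =
          C ((M : ℝ) + 2) * (X * derivative f * f ^ (M + 1)) := by
        rw [derivative_pow]
        simp only [Nat.cast_add, Nat.cast_ofNat,
          show M + 2 - 1 = M + 1 by omega]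
        ring
      rw [← coeff_C_mul, ← h1]
      rcases Nat.lt_or_ge M k with hlt | hge
      · have : M + 1 - k = 0 := by omega
        have hk' : (k : ℝ) = M + 1 := by
          have : k = M + 1 := by omega
          subst this; push_cast; ring
        rw [this, hk']; simp
      · obtain ⟨l, hl⟩ : ∃ l, M + 1 - k = l + 1 := ⟨M - k, by omega⟩
        have hl' : (M : ℝ) + 1 - k = l + 1 := by
          have : M = l + k := by omega
          subst this; push_cast; ring
        rw [hl, hl', coeff_X_mul, coeff_derivative]; ring
    -- The induction hypothesis for k + i trees carries the factor k + i: the k part sums to a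
    -- coefficient of f·f^(M+1), the i part to one of X·f'·f^(M+1). With `e3`, the claim reduces to
    -- (M+2)k + (M+1-k) = (M+1)(k+1).
    have e4 : ((M : ℝ) + 1) * ∑ i, w i * forestWeight w (M + 1) (k + i) =
        k * (f ^ (M + 2)).coeff (M + 1 - k) +
          (X * derivative f * f ^ (M + 1)).coeff (M + 1 - k) := by
      rw [e2, show f ^ (M + 2) = f * f ^ (M + 1) by ring, e1, Finset.mul_sum, Finset.mul_sum,
        ← Finset.sum_add_distrib]
      refine Finset.sum_congr rfl fun i _ => ?_
      split_ifs with hi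
      · have := ih (k := k + i) (by omega)
        push_cast at this
        rw [show M + 1 - k - (i : ℕ) = M + 1 - (k + i) by omega]
        linear_combination w i * this
      · rw [forestWeight_eq_zero_of_lt w (by omega)]; simp
    have hM1 : (M : ℝ) + 1 ≠ 0 := by positivity
    apply mul_left_cancel₀ hM1
    rw [show M + 1 + 1 - (k + 1) = M + 1 - k by omega]
    push_cast
    linear_combination ((M : ℝ) + 2) * e4 + e3

/-! ### The minimum of the free energy. -/

/-- At the minimizer of the free energy, `exp J` is the ratio `ρ / ∑ exp (-β E_i) ρ^i`. -/
theorem exp_freeEnergy_eq {D : ℕ} (E : Fin (D + 1) → ℝ) (β : ℝ)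
    (p : Fin (D + 1) → ℝ) (hp : p ∈ criticalVectors D)
    (hmin : IsMinOn (freeEnergy E β) (criticalVectors D) p)
    (ρ : ℝ) (hρ : 0 < ρ)
    (hρ_eq : ∑ i : Fin (D + 1), Real.exp (-β * E i) * ρ ^ (i : ℕ) =
      ∑ i : Fin (D + 1), ((i : ℕ) : ℝ) * Real.exp (-β * E i) * ρ ^ (i : ℕ)) :
    Real.exp (freeEnergy E β p) = ρ / ∑ i : Fin (D + 1), Real.exp (-β * E i) * ρ ^ (i : ℕ) := by
  set F := ∑ i : Fin (D + 1), Real.exp (-β * E i) * ρ ^ (i : ℕ) with hF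
  have hFpos : 0 < F := Finset.sum_pos (fun i _ => by positivity) ⟨0, Finset.mem_univ _⟩
  -- The expected minimizer; `hρ_eq` says exactly that its mean is one.
  set q : Fin (D + 1) → ℝ := fun i => Real.exp (-β * E i) * ρ ^ (i : ℕ) / F with hq
  have hqpos : ∀ i, 0 < q i := fun i => by positivity
  have hq1 : ∑ i, q i = 1 := by
    rw [hq, ← Finset.sum_div, ← hF, div_self hFpos.ne']
  have hqm : q ∈ criticalVectors D := by
    refine ⟨fun i => ⟨(hqpos i).le, ?_⟩, hq1, ?_⟩
    · rw [← hq1]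
      exact Finset.single_le_sum (f := q) (fun j _ => (hqpos j).le) (Finset.mem_univ i)
    · have : ∀ i : Fin (D + 1), ((i : ℕ) : ℝ) * q i =
          ((i : ℕ) : ℝ) * Real.exp (-β * E i) * ρ ^ (i : ℕ) / F := fun i => by
        simp only [hq]; ring
      rw [Finset.sum_congr rfl fun i _ => this i, ← Finset.sum_div, ← hρ_eq, div_self hFpos.ne']
  have hlogq : ∀ i, Real.log (q i) = -β * E i + (i : ℕ) * Real.log ρ - Real.log F := fun i => by
    simp only [hq]
    rw [Real.log_div (by positivity) hFpos.ne', Real.log_mul (by positivity) (by positivity),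
      Real.log_exp, Real.log_pow]
  -- The excess of the free energy of r over log(ρ/F) is the relative entropy of r with respect to
  -- `q`: log q_i is affine in i apart from the energy term, and the total mass and the mean of r
  -- are fixed.
  have hcross : ∀ r ∈ criticalVectors D,
      freeEnergy E β r - (Real.log ρ - Real.log F) =
        ∑ i, (r i * Real.log (r i) - r i * Real.log (q i)) := by
    rintro r ⟨-, h1, h2⟩
    have : ∀ i, r i * Real.log (r i) - r i * Real.log (q i) =
        r i * Real.log (r i) + β * (r i * E i) - (((i : ℕ) : ℝ) * r i) * Real.log ρ
          + r i * Real.log F := fun i => by rw [hlogq]; ring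
    rw [Finset.sum_congr rfl fun i _ => this i, Finset.sum_add_distrib, Finset.sum_sub_distrib,
      Finset.sum_add_distrib, ← Finset.mul_sum, ← Finset.sum_mul, ← Finset.sum_mul, h1, h2,
      freeEnergy]
    ring
  have hJq : freeEnergy E β q = Real.log ρ - Real.log F := by
    have := hcross q hqm
    simp only [sub_self, Finset.sum_const_zero] at this
    linarith
  have hJp : Real.log ρ - Real.log F ≤ freeEnergy E β p := by
    rw [← sub_nonneg, hcross p hp]
    -- Gibbs' inequality term by term, from log x ≤ x - 1 at x = q_i / p_i; vanishing p_i are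
    -- treated apart, so minimizers on the boundary need no separate exclusion.
    have : ∀ i, p i - q i ≤ p i * Real.log (p i) - p i * Real.log (q i) := fun i => by
      rcases (hp.1 i).1.eq_or_lt with h | h
      · rw [← h]; simp [(hqpos i).le]
      · have := Real.log_le_sub_one_of_pos (div_pos (hqpos i) h)
        rw [Real.log_div (hqpos i).ne' h.ne'] at this
        have h2 := mul_le_mul_of_nonneg_left this h.le
        have h3 : p i * (q i / p i - 1) = q i - p i := by field_simp
        rw [h3] at h2
        linarith
    have h2 := Finset.sum_le_sum fun i (_ : i ∈ Finset.univ) => this i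
    rw [Finset.sum_sub_distrib, hq1, hp.2.1, sub_self] at h2
    exact h2
  have : freeEnergy E β p = Real.log ρ - Real.log F :=
    le_antisymm ((hmin hqm).trans_eq hJq) hJp
  rw [this, Real.exp_sub, Real.exp_log hρ, Real.exp_log hFpos]

/-! ### The local limit theorem by Fourier inversion. -/

section LocalLimit

open Complex

theorem integral_exp_int_mul_I (m : ℤ) :
    ∫ t in (-Real.pi)..Real.pi, exp (m * t * I) = (if m = 0 then 2 * (Real.pi : ℂ) else 0 : ℂ) := by
  split_ifs with h
  · subst h
    simp only [Int.cast_zero, zero_mul, exp_zero, intervalIntegral.integral_const, real_smul]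
    push_cast; ring
  · have hc : (m : ℂ) * I ≠ 0 := by simp [h]
    have := integral_exp_mul_complex (a := -Real.pi) (b := Real.pi) hc
    rw [show (fun t : ℝ => exp (m * t * I)) = fun t : ℝ => exp (m * I * t) by
      funext t; ring_nf, this]
    have h2 : exp (m * I * Real.pi) = exp (m * I * ((-Real.pi : ℝ) : ℂ)) := by
      rw [exp_eq_exp_iff_exists_int]
      exact ⟨m, by push_cast; ring⟩
    rw [h2]; simp

open Polynomial in
/-- The coefficients of a polynomial are the Fourier coefficients of its restriction to the unit
circle. -/
theorem integral_aeval_exp_mul_I (q : ℝ[X]) (j : ℕ) :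
    ∫ t in (-Real.pi)..Real.pi, aeval (exp (t * I)) q * exp (-(j * t * I)) =
      2 * Real.pi * q.coeff j := by
  have h : ∀ t : ℝ, aeval (exp (t * I)) q * exp (-(j * t * I)) =
      ∑ n ∈ q.support, (q.coeff n : ℂ) * exp (((n - j : ℤ) : ℂ) * t * I) := fun t => by
    rw [aeval_eq_sum_range, Finset.sum_mul]
    rw [← q.sum_over_range' (f := fun n a => a • exp (t * I) ^ n * exp (-(j * t * I)))
      (fun n => by simp) _ (Nat.lt_succ_self _), Polynomial.sum]
    refine Finset.sum_congr rfl fun n _ => ?_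
    rw [real_smul, ← exp_nat_mul, mul_assoc, ← exp_add]
    congr 2; push_cast; ring
  simp_rw [h]
  rw [intervalIntegral.integral_finsetSum]
  · simp_rw [intervalIntegral.integral_const_mul, integral_exp_int_mul_I]
    simp only [sub_eq_zero, Nat.cast_inj, mul_ite, mul_zero, Finset.sum_ite_eq']
    split_ifs with hj
    · ring
    · rw [notMem_support_iff.1 hj]; simp
  · intro n _
    exact Continuous.intervalIntegrable (by fun_prop) _ _

/-- The characteristic function of the centred offspring distribution. -/
noncomputable def offspringChar {D : ℕ} (p : Fin (D + 1) → ℝ) (t : ℝ) : ℂ :=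
  ∑ i : Fin (D + 1), (p i : ℂ) * exp ((((i : ℕ) : ℂ) - 1) * t * I)

theorem continuous_offspringChar {D : ℕ} (p : Fin (D + 1) → ℝ) :
    Continuous (offspringChar p) := by
  unfold offspringChar; fun_prop

/-- Centring each of the M factors at the mean one absorbs a phase of frequency M, so of the
frequency M - k only k remains. -/
theorem two_pi_mul_coeff_offspringPoly_pow {D : ℕ} (p : Fin (D + 1) → ℝ) {M k : ℕ} (h : k ≤ M) :
    2 * Real.pi * ((offspringPoly p ^ M).coeff (M - k) : ℂ) =
      ∫ t in (-Real.pi)..Real.pi, offspringChar p t ^ M * exp (k * t * I) := by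
  rw [← integral_aeval_exp_mul_I]
  congr 1
  funext t
  have h1 : Polynomial.aeval (exp (t * I)) (offspringPoly p) = offspringChar p t * exp (t * I) := by
    simp only [offspringPoly, offspringChar, map_sum, map_mul, map_pow, Polynomial.aeval_C,
      Polynomial.aeval_X, Finset.sum_mul, coe_algebraMap]
    refine Finset.sum_congr rfl fun i _ => ?_
    rw [← exp_nat_mul, mul_assoc, ← exp_add]
    congr 2; ring
  rw [map_pow, h1, mul_pow, mul_assoc, ← exp_nat_mul, ← exp_add]
  congr 2
  push_cast [Nat.cast_sub h]; ring

/-- The squared norm is (a+b)² - 2ab(1 - cos t), and 1 - cos t ≥ 2t²/π² on [-π, π]. With x the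
subtracted term, this is at most (a+b)² - 2(a+b)x ≤ (a+b-x)². -/
theorem norm_add_mul_exp_le {a b : ℝ} (ha : 0 < a) (hb : 0 < b) {t : ℝ} (ht : |t| ≤ Real.pi) :
    ‖(a : ℂ) * exp (-t * I) + b‖ ≤ a + b - 2 * a * b / ((a + b) * Real.pi ^ 2) * t ^ 2 := by
  have hcos := Real.cos_le_one_sub_mul_cos_sq ht
  have hpi := Real.pi_pos
  have hab : 0 < a + b := by positivity
  have htp : t ^ 2 ≤ Real.pi ^ 2 := sq_le_sq' (abs_le.1 ht).1 (abs_le.1 ht).2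
  have hsq : ‖(a : ℂ) * exp (-t * I) + b‖ ^ 2 = a ^ 2 + b ^ 2 + 2 * a * b * Real.cos t := by
    rw [← ofReal_neg, exp_mul_I, ← ofReal_cos, ← ofReal_sin, ← normSq_eq_norm_sq, normSq_apply]
    simp only [add_re, mul_re, ofReal_re, ofReal_im, I_re, I_im, add_im, mul_im, Real.cos_neg,
      Real.sin_neg]
    have := Real.sin_sq_add_cos_sq t
    linear_combination a ^ 2 * this
  set x := 2 * a * b / ((a + b) * Real.pi ^ 2) * t ^ 2 with hx
  have hx0 : 0 ≤ x := by positivity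
  have hxs : x ≤ a + b := by
    have e : x = 2 * a * b / (a + b) * (t ^ 2 / Real.pi ^ 2) := by rw [hx]; field_simp
    have h1 : t ^ 2 / Real.pi ^ 2 ≤ 1 := (div_le_one (by positivity)).2 htp
    have h2 : 2 * a * b / (a + b) ≤ a + b := by
      rw [div_le_iff₀ hab]; nlinarith [sq_nonneg a, sq_nonneg b]
    rw [e]
    calc _ ≤ 2 * a * b / (a + b) * 1 := by gcongr
      _ ≤ _ := by simpa using h2
  refine abs_le_of_sq_le_sq' ?_ (by linarith) |>.2
  rw [hsq]
  have e2 : (a + b) * x = 2 * a * b / Real.pi ^ 2 * t ^ 2 := by rw [hx]; field_simp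
  have h3 : 2 * a * b * Real.cos t ≤ 2 * a * b * (1 - 2 / Real.pi ^ 2 * t ^ 2) := by gcongr
  have e4 : 2 * a * b * (1 - 2 / Real.pi ^ 2 * t ^ 2) = 2 * a * b - 2 * ((a + b) * x) := by
    rw [e2]; ring
  nlinarith [sq_nonneg x]

/-- The values 0 and 1 both have positive mass, and the cancellation between these two neighbours
already gives a bound 1 - ct² on the whole period; the other terms are bounded trivially. -/
theorem exists_norm_offspringChar_le {D : ℕ} (hD : 1 ≤ D) (p : Fin (D + 1) → ℝ)
    (hp : ∀ i, 0 < p i) (h1 : ∑ i, p i = 1) :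
    ∃ c > 0, ∀ t : ℝ, |t| ≤ Real.pi → ‖offspringChar p t‖ ≤ Real.exp (-c * t ^ 2) := by
  obtain ⟨D, rfl⟩ : ∃ l, D = l + 1 := ⟨D - 1, by omega⟩
  have ha := hp 0
  have hb := hp 1
  set a := p 0
  set b := p 1
  refine ⟨2 * a * b / ((a + b) * Real.pi ^ 2), by positivity, fun t ht => ?_⟩
  have hkey := norm_add_mul_exp_le ha hb ht
  have hrest : ‖∑ i : Fin D, (p i.succ.succ : ℂ) *
      exp ((((i.succ.succ : Fin (D + 2)) : ℕ) - 1) * t * I)‖ ≤ 1 - a - b := by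
    rw [Fin.sum_univ_succ, Fin.sum_univ_succ] at h1
    refine (norm_sum_le _ _).trans (le_of_eq ?_)
    rw [← h1]
    have : ∀ i : Fin D, ‖(p i.succ.succ : ℂ) *
        exp ((((i.succ.succ : Fin (D + 2)) : ℕ) - 1) * t * I)‖ = p i.succ.succ := fun i => by
      rw [norm_mul, norm_real, Real.norm_of_nonneg (hp _).le]
      have : ((((i.succ.succ : Fin (D + 2)) : ℕ) : ℂ) - 1) * t * I =
        ((((((i.succ.succ : Fin (D + 2)) : ℕ) : ℝ) - 1) * t : ℝ) : ℂ) * I := by push_cast; ring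
      rw [this, norm_exp_ofReal_mul_I, mul_one]
    rw [Finset.sum_congr rfl fun i _ => this i]
    simp only [Fin.succ_zero_eq_one, a, b]
    ring
  have hsplit : offspringChar p t = ((a : ℂ) * exp (-t * I) + b) +
      ∑ i : Fin D, (p i.succ.succ : ℂ) *
        exp ((((i.succ.succ : Fin (D + 2)) : ℕ) - 1) * t * I) := by
    rw [offspringChar, Fin.sum_univ_succ, Fin.sum_univ_succ, ← add_assoc]
    simp [a, b]
  rw [hsplit]
  refine (norm_add_le _ _).trans ?_
  have := Real.add_one_le_exp (-(2 * a * b / ((a + b) * Real.pi ^ 2)) * t ^ 2)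
  linarith

/-- Second-order Taylor expansion of exp at z = ix/√M, where M z² = -x² exactly for M > 0. -/
theorem tendsto_mul_exp_sub_one_sub (x : ℝ) :
    Tendsto (fun M : ℕ => (M : ℂ) * (exp (x * ((√M)⁻¹ : ℝ) * I) - 1 - x * ((√M)⁻¹ : ℝ) * I)) atTop
      (𝓝 (-(x ^ 2 / 2 : ℝ))) := by
  set z : ℕ → ℂ := fun M => x * ((√M)⁻¹ : ℝ) * I with hz
  have hinv : Tendsto (fun M : ℕ => (√(M : ℝ))⁻¹) atTop (𝓝 0) :=
    tendsto_inv_atTop_zero.comp (Real.tendsto_sqrt_atTop.comp tendsto_natCast_atTop_atTop)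
  have hz0 : Tendsto z atTop (𝓝 0) := by
    have h : Tendsto (fun M : ℕ => (((√(M : ℝ))⁻¹ : ℝ) : ℂ)) atTop (𝓝 ((0 : ℝ) : ℂ)) :=
      (continuous_ofReal.tendsto 0).comp hinv
    have h2 := (h.const_mul (x : ℂ)).mul_const I
    rwa [ofReal_zero, mul_zero, zero_mul] at h2
  have hMz : ∀ᶠ M : ℕ in atTop, (M : ℂ) * z M ^ 2 = -(x ^ 2 : ℝ) := by
    filter_upwards [eventually_gt_atTop 0] with M hM
    have hM' : (0 : ℝ) < M := by exact_mod_cast hM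
    have : (((√(M : ℝ))⁻¹ : ℝ) : ℂ) ^ 2 = (M : ℂ)⁻¹ := by
      rw [← ofReal_pow, inv_pow, Real.sq_sqrt hM'.le]; push_cast; rfl
    have hM0 : (M : ℂ) ≠ 0 := by exact_mod_cast hM.ne'
    simp only [hz, mul_pow, this, I_sq]
    push_cast
    field_simp
  have ho := (exp_sub_sum_range_succ_isLittleO_pow 2).comp_tendsto hz0
  have ho2 : (fun M : ℕ => (M : ℂ) * (exp (z M) - ∑ i ∈ Finset.range 3, z M ^ i / (i.factorial : ℂ)))
      =o[atTop] fun M : ℕ => (M : ℂ) * z M ^ 2 :=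
    (Asymptotics.isBigO_refl (fun M : ℕ => (M : ℂ)) atTop).mul_isLittleO ho
  have ho3 := (ho2.congr' (EventuallyEq.refl _ _) hMz).tendsto_zero_of_tendsto tendsto_const_nhds
  have hlim := ho3.add (tendsto_const_nhds (x := (-(x ^ 2 / 2 : ℝ) : ℂ)) (f := atTop))
  rw [zero_add] at hlim
  refine hlim.congr' ?_
  filter_upwards [hMz] with M hM
  have : (-(x ^ 2 / 2 : ℝ) : ℂ) = M * z M ^ 2 / 2 := by rw [hM]; push_cast; ring
  rw [this]
  change _ = (M : ℂ) * (exp (z M) - 1 - z M)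
  simp only [Finset.sum_range_succ, Finset.sum_range_zero, Nat.factorial]
  push_cast
  ring

/-- The central limit theorem for characteristic functions: mean one kills the linear terms, the
quadratic ones add up to minus half the variance times u², and (1 + a_M/M)^M → e^a when a_M → a. -/
theorem tendsto_offspringChar_pow {D : ℕ} (p : Fin (D + 1) → ℝ)
    (h1 : ∑ i, p i = 1) (hm : ∑ i : Fin (D + 1), ((i : ℕ) : ℝ) * p i = 1) (u : ℝ) :
    Tendsto (fun M : ℕ => offspringChar p (u / √M) ^ M) atTop
      (𝓝 (exp (-((∑ i : Fin (D + 1), p i * (((i : ℕ) : ℝ) - 1) ^ 2) / 2 * u ^ 2 : ℝ)))) := by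
  have hsum : Tendsto (fun M : ℕ => (M : ℂ) * (offspringChar p (u / √M) - 1)) atTop
      (𝓝 (∑ i : Fin (D + 1), (p i : ℂ) * -((((((i : ℕ) : ℝ) - 1) * u) ^ 2 / 2 : ℝ) : ℂ))) := by
    have := tendsto_finsetSum (Finset.univ : Finset (Fin (D + 1))) fun i _ =>
      (tendsto_mul_exp_sub_one_sub ((((i : ℕ) : ℝ) - 1) * u)).const_mul (p i : ℂ)
    refine this.congr fun M => ?_
    have e0 : ∑ i : Fin (D + 1), (p i : ℂ) * (((i : ℕ) : ℂ) - 1) = 0 := by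
      have : ∑ i : Fin (D + 1), p i * (((i : ℕ) : ℝ) - 1) = 0 := by
        simp_rw [mul_sub, mul_one, Finset.sum_sub_distrib, mul_comm (p _), hm, h1, sub_self]
      exact_mod_cast this
    have e1 : ∑ i : Fin (D + 1), (p i : ℂ) = 1 := by exact_mod_cast h1
    have : ∀ i : Fin (D + 1), (p i : ℂ) * ((M : ℂ) *
        (exp (((((i : ℕ) : ℝ) - 1) * u : ℝ) * ((√M)⁻¹ : ℝ) * I) - 1 -
          ((((i : ℕ) : ℝ) - 1) * u : ℝ) * ((√M)⁻¹ : ℝ) * I)) =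
        M * (p i * exp ((((i : ℕ) : ℂ) - 1) * ((u / √M : ℝ) : ℂ) * I)) - M * p i
          - M * u * ((√M)⁻¹ : ℝ) * I * (p i * (((i : ℕ) : ℂ) - 1)) := fun i => by
      have : (((((i : ℕ) : ℝ) - 1) * u : ℝ) : ℂ) * ((√M)⁻¹ : ℝ) * I =
        (((i : ℕ) : ℂ) - 1) * ((u / √M : ℝ) : ℂ) * I := by push_cast; ring
      rw [this]; push_cast; ring
    rw [Finset.sum_congr rfl fun i _ => this i, Finset.sum_sub_distrib, Finset.sum_sub_distrib,
      ← Finset.mul_sum, ← Finset.mul_sum, ← Finset.mul_sum, e0, e1, offspringChar]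
    ring
  have h2 := tendsto_one_add_pow_exp_of_tendsto hsum
  simp only [add_sub_cancel] at h2
  convert! h2 using 3
  push_cast
  rw [Finset.sum_div, Finset.sum_mul, ← Finset.sum_neg_distrib]
  exact Finset.sum_congr rfl fun i _ => by ring

/-- The local limit theorem near the mean for a probability distribution `p` on `{0, ..., D}` with
mean one. -/
theorem exists_tendsto_sqrt_mul_coeff {D : ℕ} (hD : 1 ≤ D) (p : Fin (D + 1) → ℝ)
    (hp : ∀ i, 0 < p i) (h1 : ∑ i, p i = 1) (hm : ∑ i : Fin (D + 1), ((i : ℕ) : ℝ) * p i = 1) :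
    ∃ c > 0, ∀ k : ℕ, Tendsto (fun M : ℕ => √(M : ℝ) * (offspringPoly p ^ M).coeff (M - k)) atTop
      (𝓝 c) := by
  obtain ⟨b, hb, hbound⟩ := exists_norm_offspringChar_le hD p hp h1
  set s := (∑ i : Fin (D + 1), p i * (((i : ℕ) : ℝ) - 1) ^ 2) / 2 with hs
  have hs0 : 0 < s := by
    refine div_pos (Finset.sum_pos' (fun i _ => by have := hp i; positivity)
      ⟨0, Finset.mem_univ _, ?_⟩) two_pos
    simpa using hp 0
  -- As `s` is half the variance v, this is 1/√(2πv), the Gaussian density at the mean.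
  refine ⟨√(Real.pi / s) / (2 * Real.pi), by positivity, fun k => ?_⟩
  -- The Fourier integrand after t = u/√M, extended by zero to the line. The bound on the
  -- characteristic function, raised to the power M, dominates it by a Gaussian free of M.
  set F : ℕ → ℝ → ℂ := fun M => (Set.Ioc (-(Real.pi * √M)) (Real.pi * √M)).indicator
    fun u => offspringChar p (u / √M) ^ M * exp (k * (u / √M : ℝ) * I) with hF
  have hlim : Tendsto (fun M => ∫ u, F M u) atTop (𝓝 (∫ u : ℝ, exp (-(s * u ^ 2 : ℝ)))) := by
    refine tendsto_integral_of_dominated_convergence (fun u => Real.exp (-b * u ^ 2)) ?_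
      (integrable_exp_neg_mul_sq hb) ?_ ?_
    · intro M
      refine (Continuous.aestronglyMeasurable ?_).indicator measurableSet_Ioc
      have := continuous_offspringChar p
      fun_prop
    · refine fun M => Eventually.of_forall fun u => ?_
      simp only [hF, Set.indicator_apply]
      split_ifs with hu
      · have hM : 0 < M := by
          rcases Nat.eq_zero_or_pos M with rfl | h
          · simp at hu
          · exact h
        have hM' : (0 : ℝ) < √M := Real.sqrt_pos.2 (by exact_mod_cast hM)
        have habs : |u / √M| ≤ Real.pi := by
          rw [abs_div, abs_of_pos hM', div_le_iff₀ hM']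
          exact abs_le.2 ⟨hu.1.le, hu.2⟩
        have e : (k : ℂ) * ((u / √M : ℝ) : ℂ) * I = ((k * (u / √M) : ℝ) : ℂ) * I := by
          push_cast; ring
        rw [norm_mul, norm_pow, e, norm_exp_ofReal_mul_I, mul_one]
        calc _ ≤ Real.exp (-b * (u / √M) ^ 2) ^ M := by gcongr; exact hbound _ habs
          _ = _ := by
            rw [← Real.exp_nat_mul, div_pow, Real.sq_sqrt (by positivity)]
            congr 1
            have : (M : ℝ) ≠ 0 := by positivity
            field_simp
      · simpa using (Real.exp_pos _).le
    · refine Eventually.of_forall fun u => ?_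
      have hpow := tendsto_offspringChar_pow p h1 hm u
      have hinv : Tendsto (fun M : ℕ => u / √(M : ℝ)) atTop (𝓝 0) :=
        tendsto_const_nhds.div_atTop (Real.tendsto_sqrt_atTop.comp tendsto_natCast_atTop_atTop)
      have hcont : Continuous fun x : ℝ => exp (k * (x : ℂ) * I) := by fun_prop
      have h2 := (hcont.tendsto 0).comp hinv
      have h3 := hpow.mul h2
      simp only [ofReal_zero, mul_zero, zero_mul, exp_zero, mul_one] at h3
      rw [← ofReal_neg]
      rw [← ofReal_neg] at h3
      refine h3.congr' ?_
      have hbig : Tendsto (fun M : ℕ => Real.pi * √(M : ℝ)) atTop atTop :=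
        (Real.tendsto_sqrt_atTop.comp tendsto_natCast_atTop_atTop).const_mul_atTop Real.pi_pos
      filter_upwards [hbig.eventually_gt_atTop |u|] with M hM
      have hu := abs_lt.1 hM
      simp only [hF]
      rw [Set.indicator_of_mem (Set.mem_Ioc.2 ⟨hu.1, hu.2.le⟩)]
      rfl
  have hgauss : ∫ u : ℝ, exp (-(s * u ^ 2 : ℝ)) = (√(Real.pi / s) : ℝ) := by
    rw [← integral_gaussian, ← integral_complex_ofReal]
    congr 1; funext u; push_cast; congr 1; ring
  rw [hgauss] at hlim
  have hre := (continuous_re.tendsto _).comp hlim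
  rw [ofReal_re] at hre
  refine (hre.div_const (2 * Real.pi)).congr' ?_
  filter_upwards [eventually_ge_atTop k, eventually_gt_atTop 0] with M hk hM
  have hM' : (0 : ℝ) < √M := Real.sqrt_pos.2 (by exact_mod_cast hM)
  have e1 : ∫ u, F M u = (√M : ℝ) * (2 * Real.pi * ((offspringPoly p ^ M).coeff (M - k) : ℂ)) := by
    rw [two_pi_mul_coeff_offspringPoly_pow p hk, hF]
    simp only
    rw [integral_indicator measurableSet_Ioc, ← intervalIntegral.integral_of_le (by
      have := Real.pi_pos; nlinarith)]
    have := intervalIntegral.integral_comp_div (a := -(Real.pi * √M)) (b := Real.pi * √M)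
      (fun t : ℝ => offspringChar p t ^ M * exp (k * t * I)) hM'.ne'
    rw [this, real_smul, neg_div, mul_div_cancel_right₀ _ hM'.ne']
  simp only [Function.comp_apply]
  have e2 : ((√M : ℝ) : ℂ) * (2 * Real.pi * ((offspringPoly p ^ M).coeff (M - k) : ℂ)) =
    ((√M * (2 * Real.pi * (offspringPoly p ^ M).coeff (M - k)) : ℝ) : ℂ) := by push_cast; ring
  rw [e1, e2, ofReal_re]
  have := Real.pi_pos.ne'
  field_simp

end LocalLimit

/-! ### Asymptotics of forest weights and of their ratios. -/

section RatioLimit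

variable {D : ℕ} (w : Fin (D + 1) → ℝ) (ρ : ℝ)

open Polynomial in
/-- Exponential tilting of the weights. -/
theorem coeff_offspringPoly_tilt_pow {F : ℝ} (hF : F ≠ 0) (M n : ℕ) :
    F ^ M * (offspringPoly (fun i => w i * ρ ^ (i : ℕ) / F) ^ M).coeff n =
      ρ ^ n * (offspringPoly w ^ M).coeff n := by
  have h : C F * offspringPoly (fun i => w i * ρ ^ (i : ℕ) / F) =
      (offspringPoly w).comp (C ρ * X) := by
    simp only [offspringPoly, Polynomial.sum_comp, Finset.mul_sum, mul_comp, C_comp, X_pow_comp]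
    refine Finset.sum_congr rfl fun i _ => ?_
    rw [← mul_assoc, ← C_mul, mul_div_cancel₀ _ hF, mul_pow, C_mul, C_pow, mul_assoc]
  rw [← coeff_C_mul, C_pow, ← mul_pow, h, ← pow_comp, comp_C_mul_X_coeff, mul_comm]

/-- Otter-Dwass reduces to a coefficient of a power, and tilting by ρ makes the weights a law of
mean one. The order of quantifiers matters: c serves all k at once, so it cancels in ratios. -/
theorem exists_tendsto_forestWeight (hD : 1 ≤ D) (hw : ∀ i, 0 < w i) (hρ : 0 < ρ)
    (hρ_eq : ∑ i : Fin (D + 1), w i * ρ ^ (i : ℕ) =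
      ∑ i : Fin (D + 1), ((i : ℕ) : ℝ) * w i * ρ ^ (i : ℕ)) :
    ∃ c > 0, ∀ k : ℕ, Tendsto (fun M : ℕ => forestWeight w M k * (M * √(M : ℝ)) *
      (ρ / ∑ i : Fin (D + 1), w i * ρ ^ (i : ℕ)) ^ M) atTop (𝓝 (k * ρ ^ k * c)) := by
  set F := ∑ i : Fin (D + 1), w i * ρ ^ (i : ℕ) with hF
  have hFpos : 0 < F := Finset.sum_pos (fun i _ => mul_pos (hw i) (by positivity))
    ⟨0, Finset.mem_univ _⟩
  obtain ⟨c, hc, hlim⟩ := exists_tendsto_sqrt_mul_coeff hD (fun i => w i * ρ ^ (i : ℕ) / F)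
    (fun i => div_pos (mul_pos (hw i) (by positivity)) hFpos)
    (by rw [← Finset.sum_div, ← hF, div_self hFpos.ne'])
    (by simp_rw [← mul_div_assoc, ← mul_assoc]
        rw [← Finset.sum_div, ← hρ_eq, div_self hFpos.ne'])
  refine ⟨c, hc, fun k => ((hlim k).const_mul (k * ρ ^ k)).congr' ?_⟩
  filter_upwards [eventually_ge_atTop k, eventually_gt_atTop 0] with M hk hM
  have h1 := mul_forestWeight w hM hk
  have h2 := coeff_offspringPoly_tilt_pow w ρ hFpos.ne' M (M - k)
  have h3 : ρ ^ M = ρ ^ k * ρ ^ (M - k) := by rw [← pow_add]; congr 1; omega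
  rw [div_pow, h3]
  field_simp
  linear_combination k * h2 - ρ ^ (M - k) * h1

theorem eventually_forestWeight_one_pos (hD : 1 ≤ D) (hw : ∀ i, 0 < w i) (hρ : 0 < ρ)
    (hρ_eq : ∑ i : Fin (D + 1), w i * ρ ^ (i : ℕ) =
      ∑ i : Fin (D + 1), ((i : ℕ) : ℝ) * w i * ρ ^ (i : ℕ)) :
    ∀ᶠ N : ℕ in atTop, 0 < forestWeight w N 1 := by
  obtain ⟨c, hc, h⟩ := exists_tendsto_forestWeight w ρ hD hw hρ hρ_eq
  have hFpos : 0 < ∑ i : Fin (D + 1), w i * ρ ^ (i : ℕ) :=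
    Finset.sum_pos (fun i _ => mul_pos (hw i) (by positivity)) ⟨0, Finset.mem_univ _⟩
  filter_upwards [(h 1).eventually_const_lt (u := 0) (by positivity)] with N hN
  by_contra hneg
  have : 0 ≤ (N * √(N : ℝ)) * (ρ / ∑ i : Fin (D + 1), w i * ρ ^ (i : ℕ)) ^ N := by positivity
  rw [mul_assoc] at hN
  nlinarith [mul_nonneg (sub_nonneg.2 (not_lt.1 hneg)) this]

theorem tendsto_forestWeight_div (hD : 1 ≤ D) (hw : ∀ i, 0 < w i) (hρ : 0 < ρ)
    (hρ_eq : ∑ i : Fin (D + 1), w i * ρ ^ (i : ℕ) =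
      ∑ i : Fin (D + 1), ((i : ℕ) : ℝ) * w i * ρ ^ (i : ℕ)) (m k : ℕ) :
    Tendsto (fun N : ℕ => forestWeight w (N - m) k / forestWeight w N 1) atTop
      (𝓝 (k * (ρ ^ k / ρ) * (ρ / ∑ i : Fin (D + 1), w i * ρ ^ (i : ℕ)) ^ m)) := by
  obtain ⟨c, hc, h⟩ := exists_tendsto_forestWeight w ρ hD hw hρ hρ_eq
  have hFpos : 0 < ∑ i : Fin (D + 1), w i * ρ ^ (i : ℕ) :=
    Finset.sum_pos (fun i _ => mul_pos (hw i) (by positivity)) ⟨0, Finset.mem_univ _⟩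
  set s := ρ / ∑ i : Fin (D + 1), w i * ρ ^ (i : ℕ) with hs
  have hs0 : 0 < s := by positivity
  have hpos := eventually_forestWeight_one_pos w ρ hD hw hρ hρ_eq
  -- Substituting N = n + m removes the truncated subtraction.
  rw [← tendsto_add_atTop_iff_nat m]
  have hr : Tendsto (fun n : ℕ => ((n + m : ℕ) : ℝ) / n) atTop (𝓝 1) := by
    have h1 : Tendsto (fun n : ℕ => 1 + (m : ℝ) / n) atTop (𝓝 (1 + 0)) :=
      tendsto_const_nhds.add (tendsto_const_nhds.div_atTop tendsto_natCast_atTop_atTop)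
    rw [add_zero] at h1
    refine h1.congr' ?_
    filter_upwards [eventually_gt_atTop 0] with n hn
    push_cast
    field_simp
  have hlim := ((((h k).div ((tendsto_add_atTop_iff_nat m).2 (h 1)) (by positivity)).mul hr).mul
    ((Real.continuous_sqrt.tendsto 1).comp hr)).mul_const (s ^ m)
  have e : (k : ℝ) * ρ ^ k * c / ((1 : ℕ) * ρ ^ 1 * c) * 1 * √1 * s ^ m =
      k * (ρ ^ k / ρ) * s ^ m := by
    rw [Real.sqrt_one]; push_cast; field_simp
  rw [e] at hlim
  refine hlim.congr' ?_
  filter_upwards [eventually_gt_atTop 0, (tendsto_add_atTop_nat m).eventually hpos] with n hn hp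
  have hn' : (0 : ℝ) < n := by exact_mod_cast hn
  have hnm : (0 : ℝ) < (n + m : ℕ) := by positivity
  have h1 : (0 : ℝ) < √(n : ℝ) := Real.sqrt_pos.2 hn'
  have h2 : (0 : ℝ) < √((n + m : ℕ) : ℝ) := Real.sqrt_pos.2 hnm
  simp only [Function.comp_apply, Pi.div_apply, Real.sqrt_div hnm.le, Nat.add_sub_cancel]
  rw [pow_add]
  field_simp

end RatioLimit

/-! ### Partition sums over cylinders. -/

namespace PlaneTree

variable {D : ℕ}

theorem mem_of_append_mem {T : PlaneTree D} {v : List (Fin D)} {i : Fin D}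
    (h : v ++ [i] ∈ T.verts) : v ∈ T.verts :=
  T.prefix_mem _ _ (List.prefix_append _ _) h

theorem mem_iff_lt_card_of_lower (A : Finset (Fin D)) (hA : ∀ i j, j ≤ i → i ∈ A → j ∈ A)
    (i : Fin D) : i ∈ A ↔ (i : ℕ) < A.card := by
  constructor
  · intro hi
    have : Finset.Iic i ⊆ A := fun j hj => hA i j (Finset.mem_Iic.1 hj) hi
    have := Finset.card_le_card this
    rw [Fin.card_Iic] at this
    omega
  · intro hi
    by_contra hn
    have : A ⊆ Finset.Iio i := fun j hj => by
      rw [Finset.mem_Iio]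
      by_contra hle
      exact hn (hA j i (not_lt.1 hle) hj)
    have := Finset.card_le_card this
    rw [Fin.card_Iio] at this
    omega

theorem append_mem_iff {T : PlaneTree D} {v : List (Fin D)} {i : Fin D} :
    v ++ [i] ∈ T.verts ↔ (i : ℕ) < T.deg v := by
  classical
  have := mem_iff_lt_card_of_lower (Finset.univ.filter fun i : Fin D => v ++ [i] ∈ T.verts)
    (fun i j hij hi => by
      simp only [Finset.mem_filter, Finset.mem_univ, true_and] at hi ⊢
      exact T.left_mem v i j hij hi) i
  simp only [Finset.mem_filter, Finset.mem_univ, true_and] at this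
  rw [this, deg]

theorem deg_eq_iff {T : PlaneTree D} {v : List (Fin D)} {c : Fin (D + 1)} :
    T.deg v = c ↔ ∀ i : Fin D, v ++ [i] ∈ T.verts ↔ (i : ℕ) < c := by
  constructor
  · rintro rfl i; exact append_mem_iff
  · intro h
    simp only [append_mem_iff] at h
    by_contra hne
    rcases lt_or_gt_of_ne hne with hlt | hlt
    · have := (h ⟨T.deg v, by omega⟩).2 hlt
      simp at this
    · have := (h ⟨c, by omega⟩).1 hlt
      simp at this

/-- The event that the vertices in `S` are present and have the branching numbers `d`. -/
def cylinder (S : Finset (List (Fin D))) (d : List (Fin D) → Fin (D + 1)) : Set (PlaneTree D) :=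
  {T | ∀ v ∈ S, v ∈ T.verts ∧ T.deg v = d v}

open Classical in
/-- The children of `v` if it has branching number `c`. -/
def children (v : List (Fin D)) (c : Fin (D + 1)) : Finset (List (Fin D)) :=
  (Finset.univ.filter fun i : Fin D => (i : ℕ) < c).image fun i => v ++ [i]

open Classical in
/-- The root and the children of the vertices in `S` if these have the branching numbers `d`. -/
def hull (S : Finset (List (Fin D))) (d : List (Fin D) → Fin (D + 1)) : Finset (List (Fin D)) :=
  insert [] (S.biUnion fun v => children v (d v))

theorem mem_children {u v : List (Fin D)} {c : Fin (D + 1)} :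
    u ∈ children v c ↔ ∃ i : Fin D, (i : ℕ) < c ∧ u = v ++ [i] := by
  simp [children, eq_comm]

theorem nil_mem_hull (S : Finset (List (Fin D))) (d : List (Fin D) → Fin (D + 1)) :
    [] ∈ hull S d := by simp [hull]

theorem append_mem_hull {S : Finset (List (Fin D))} {d : List (Fin D) → Fin (D + 1)}
    {v : List (Fin D)} {i : Fin D} : v ++ [i] ∈ hull S d ↔ v ∈ S ∧ (i : ℕ) < d v := by
  simp only [hull, Finset.mem_insert, Finset.mem_biUnion, mem_children]
  constructor
  · rintro (h | ⟨u, hu, j, hj, h⟩)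
    · simp at h
    · obtain ⟨rfl, h2⟩ := List.append_inj' h rfl
      obtain rfl : i = j := by simpa using h2
      exact ⟨hu, hj⟩
  · rintro ⟨h1, h2⟩
    exact Or.inr ⟨v, h1, i, h2, rfl⟩

theorem card_children (v : List (Fin D)) (c : Fin (D + 1)) : (children v c).card = c := by
  rw [children, Finset.card_image_of_injective _ fun i j h => by simpa using h]
  rw [Fin.card_filter_val_lt]
  omega

theorem pairwiseDisjoint_children (s : Set (List (Fin D))) (d : List (Fin D) → Fin (D + 1)) :
    s.PairwiseDisjoint fun v => children v (d v) := by
  intro u _ v _ huv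
  rw [Function.onFun, Finset.disjoint_left]
  intro x hx hx'
  obtain ⟨i, -, rfl⟩ := mem_children.1 hx
  obtain ⟨j, -, h⟩ := mem_children.1 hx'
  exact huv (List.append_inj' h rfl).1

theorem card_hull (S : Finset (List (Fin D))) (d : List (Fin D) → Fin (D + 1)) :
    (hull S d).card = 1 + ∑ v ∈ S, (d v : ℕ) := by
  rw [hull, Finset.card_insert_of_notMem, Finset.card_biUnion, add_comm]
  · simp_rw [card_children]
  · exact pairwiseDisjoint_children _ _
  · simp [mem_children]

theorem hull_subset_verts {S : Finset (List (Fin D))} {d : List (Fin D) → Fin (D + 1)}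
    {T : PlaneTree D} (hT : T ∈ cylinder S d) : (hull S d : Set (List (Fin D))) ⊆ T.verts := by
  intro v hv
  rcases List.eq_nil_or_concat' v with rfl | ⟨u, i, rfl⟩
  · exact T.root_mem
  · obtain ⟨hu, hi⟩ := append_mem_hull.1 hv
    rw [append_mem_iff, (hT u hu).2]
    exact hi

theorem verts_eq_of_hull_eq {S : Finset (List (Fin D))} {d : List (Fin D) → Fin (D + 1)}
    (hS : hull S d = S) {T : PlaneTree D} (hT : T ∈ cylinder S d) : T.verts = S := by
  refine Set.Subset.antisymm (fun v hv => ?_) fun v hv => (hT v hv).1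
  induction v using List.reverseRecOn with
  | nil => rw [← hS]; exact nil_mem_hull S d
  | append_singleton v i ih =>
    have hvS := ih (mem_of_append_mem hv)
    rw [← hS]
    refine append_mem_hull.2 ⟨hvS, ?_⟩
    rw [← (hT v hvS).2]
    exact append_mem_iff.1 hv

/-- The finite tree with vertex set `S` and branching numbers `d`. -/
def ofHullEq (S : Finset (List (Fin D))) (d : List (Fin D) → Fin (D + 1)) (hS : hull S d = S) :
    PlaneTree D where
  verts := S
  root_mem := by
    have := nil_mem_hull S d
    rwa [hS] at this
  prefix_mem u v huv hv := by
    induction v using List.reverseRecOn with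
    | nil => rw [List.prefix_nil.1 huv]; exact hv
    | append_singleton v i ih =>
      rcases List.prefix_concat_iff.1 huv with h | h
      · rwa [h]
      · refine ih h ?_
        have : v ++ [i] ∈ hull S d := by rw [hS]; exact hv
        exact (append_mem_hull.1 this).1
  left_mem v i j hji hv := by
    have hv' : v ++ [i] ∈ hull S d := by rw [hS]; exact hv
    obtain ⟨h1, h2⟩ := append_mem_hull.1 hv'
    have : v ++ [j] ∈ hull S d := append_mem_hull.2 ⟨h1, lt_of_le_of_lt hji h2⟩
    rwa [hS] at this

theorem ofHullEq_mem_cylinder {S : Finset (List (Fin D))} {d : List (Fin D) → Fin (D + 1)}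
    (hS : hull S d = S) : ofHullEq S d hS ∈ cylinder S d := by
  intro v hv
  refine ⟨hv, deg_eq_iff.2 fun i => ?_⟩
  have : v ++ [i] ∈ hull S d ↔ v ++ [i] ∈ S := by rw [hS]
  change v ++ [i] ∈ S ↔ _
  rw [← this, append_mem_hull]
  exact and_iff_right hv

open Classical in
/-- The total weight of the trees on `N` vertices in the event `A`. -/
noncomputable def partitionSum (E : Fin (D + 1) → ℝ) (β : ℝ) (N : ℕ) (A : Set (PlaneTree D)) : ℝ :=
  ∑ T ∈ (finite_ofSize D N).toFinset with T ∈ A, Real.exp (-β * T.energy E)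

theorem exp_energy_of_verts_eq (E : Fin (D + 1) → ℝ) (β : ℝ) {T : PlaneTree D}
    {S : Finset (List (Fin D))} (h : T.verts = S) :
    Real.exp (-β * T.energy E) = ∏ v ∈ S, Real.exp (-β * E (T.deg v)) := by
  rw [energy, h, finsum_mem_coe_finset, Finset.mul_sum, Real.exp_sum]

/-- With no vertices left over, the vertex set must be S itself. There is then exactly one tree if
no discovered vertex is unexplored, and none otherwise. -/
theorem partitionSum_cylinder_card (E : Fin (D + 1) → ℝ) (β : ℝ) (S : Finset (List (Fin D)))
    (d : List (Fin D) → Fin (D + 1)) (hS : S ⊆ hull S d) :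
    partitionSum E β S.card (cylinder S d) = (∏ v ∈ S, Real.exp (-β * E (d v))) *
      forestWeight (fun i => Real.exp (-β * E i)) 0 ((hull S d).card - S.card) := by
  classical
  have hverts : ∀ T ∈ ofSize D S.card, T ∈ cylinder S d → T.verts = S := fun T hT hT' => by
    have hT : T.verts.encard = S.card := hT
    exact (S.finite_toSet.eq_of_subset_of_encard_le (fun v hv => (hT' v hv).1)
      (by rw [hT, Set.encard_coe_eq_coe_finsetCard])).symm
  by_cases h : hull S d = S
  · rw [h, Nat.sub_self]
    have hf : ((finite_ofSize D S.card).toFinset.filter fun T => T ∈ cylinder S d) =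
        {ofHullEq S d h} := by
      ext T
      simp only [Finset.mem_filter, Set.Finite.mem_toFinset, Finset.mem_singleton]
      constructor
      · rintro ⟨h1, h2⟩
        exact PlaneTree.ext (hverts T h1 h2)
      · rintro rfl
        exact ⟨Set.encard_coe_eq_coe_finsetCard S, ofHullEq_mem_cylinder h⟩
    rw [partitionSum]
    simp only [forestWeight, if_true, mul_one]
    rw [hf, Finset.sum_singleton, exp_energy_of_verts_eq E β (S := S) rfl]
    exact Finset.prod_congr rfl fun v hv => by rw [(ofHullEq_mem_cylinder h v hv).2]
  · have hlt : S.card < (hull S d).card :=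
      Finset.card_lt_card (Finset.ssubset_iff_subset_ne.2 ⟨hS, fun h' => h h'.symm⟩)
    simp only [forestWeight, show (hull S d).card - S.card ≠ 0 by omega, if_false, mul_zero]
    rw [partitionSum, Finset.sum_eq_zero]
    intro T hT
    simp only [Finset.mem_filter, Set.Finite.mem_toFinset] at hT
    have h2 := hull_subset_verts hT.2
    rw [hverts T hT.1 hT.2] at h2
    exact absurd (Finset.card_le_card (Finset.coe_subset.1 h2)) (by omega)

/-- The elements of `hull S d` outside S are the roots of the unexplored forest. Exploring one of
them, with c children, adds one vertex to S and c to the hull, which is the recursion of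
`forestWeight`. The hypothesis on S says that S is reached from the root through itself,
consistently with d. -/
theorem partitionSum_cylinder (E : Fin (D + 1) → ℝ) (β : ℝ) (M : ℕ) (S : Finset (List (Fin D)))
    (d : List (Fin D) → Fin (D + 1)) (hS : S ⊆ hull S d) :
    partitionSum E β (S.card + M) (cylinder S d) = (∏ v ∈ S, Real.exp (-β * E (d v))) *
      forestWeight (fun i => Real.exp (-β * E i)) M ((hull S d).card - S.card) := by
  classical
  induction M generalizing S d with
  | zero => exact partitionSum_cylinder_card E β S d hS
  | succ M ih =>
    by_cases h : hull S d = S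
    -- Nothing is left to explore, so every tree of the cylinder has only |S| vertices, too few.
    · rw [h, Nat.sub_self]
      simp only [forestWeight, mul_zero]
      rw [partitionSum, Finset.sum_eq_zero]
      intro T hT
      simp only [Finset.mem_filter, Set.Finite.mem_toFinset] at hT
      have h1 : T.verts.encard = (S.card + (M + 1) : ℕ) := hT.1
      rw [verts_eq_of_hull_eq h hT.2, Set.encard_coe_eq_coe_finsetCard] at h1
      have : S.card = S.card + (M + 1) := by exact_mod_cast h1
      omega
    · obtain ⟨b, hb, hbS⟩ := Finset.exists_of_ssubset
        (Finset.ssubset_iff_subset_ne.2 ⟨hS, fun h' => h h'.symm⟩)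
      have hne : ∀ v ∈ S, v ≠ b := fun v hv hvb => hbS (hvb ▸ hv)
      have hd : ∀ c, ∀ v ∈ S, Function.update d b c v = d v := fun c v hv =>
        Function.update_of_ne (hne v hv) _ _
      have hsub : ∀ c, hull S d ⊆ hull (insert b S) (Function.update d b c) := fun c v hv => by
        rcases List.eq_nil_or_concat' v with rfl | ⟨u, i, rfl⟩
        · exact nil_mem_hull _ _
        · obtain ⟨hu, hi⟩ := append_mem_hull.1 hv
          exact append_mem_hull.2 ⟨Finset.mem_insert_of_mem hu, by rwa [hd c u hu]⟩
      have hsub' : ∀ c, insert b S ⊆ hull (insert b S) (Function.update d b c) := fun c =>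
        Finset.insert_subset (hsub c hb) (hS.trans (hsub c))
      have hcard : ∀ c : Fin (D + 1), (hull (insert b S) (Function.update d b c)).card =
          (hull S d).card + c := fun c => by
        rw [card_hull, card_hull, Finset.sum_insert hbS, Function.update_self,
          Finset.sum_congr rfl fun v hv => by rw [hd c v hv]]
        ring
      -- Every tree of the cylinder contains b, so its trees can be sorted by the branching number
      -- of b.
      have hpart : partitionSum E β (S.card + (M + 1)) (cylinder S d) =
          ∑ c, partitionSum E β (S.card + (M + 1))
            (cylinder (insert b S) (Function.update d b c)) := by
        simp only [partitionSum]
        rw [← Finset.sum_fiberwise _ (fun T : PlaneTree D => T.deg b)]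
        refine Finset.sum_congr rfl fun c _ => Finset.sum_congr ?_ fun _ _ => rfl
        ext T
        simp only [Finset.mem_filter, and_assoc, and_congr_right_iff]
        refine fun _ => ⟨?_, ?_⟩
        · rintro ⟨h1, h2⟩ v hv
          rcases Finset.mem_insert.1 hv with rfl | hv
          · exact ⟨hull_subset_verts h1 hb, by rw [Function.update_self, h2]⟩
          · rw [hd c v hv]; exact h1 v hv
        · intro h1
          refine ⟨fun v hv => ?_, ?_⟩
          · rw [← hd c v hv]; exact h1 v (Finset.mem_insert_of_mem hv)
          · rw [(h1 b (Finset.mem_insert_self b S)).2, Function.update_self]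
      have hcb : (insert b S).card = S.card + 1 := Finset.card_insert_of_notMem hbS
      have hlt : S.card < (hull S d).card :=
        Finset.card_lt_card (Finset.ssubset_iff_subset_ne.2 ⟨hS, fun h' => h h'.symm⟩)
      obtain ⟨k, hk⟩ : ∃ k, (hull S d).card = S.card + (k + 1) :=
        ⟨(hull S d).card - S.card - 1, by omega⟩
      rw [hpart, hk, Nat.add_sub_cancel_left]
      simp only [forestWeight, Finset.mul_sum]
      refine Finset.sum_congr rfl fun c _ => ?_
      have := ih (insert b S) (Function.update d b c) (hsub' c)
      rw [hcard, hcb, hk, show S.card + 1 + M = S.card + (M + 1) by ring,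
        show S.card + (k + 1) + (c : ℕ) - (S.card + 1) = k + c by omega,
        Finset.prod_insert hbS, Function.update_self,
        Finset.prod_congr rfl fun v hv => by rw [hd c v hv]] at this
      rw [this]; ring

end PlaneTree

/-! ### Limits of cylinder probabilities, local events, and uniqueness. -/

namespace PlaneTree

variable {D : ℕ}

theorem gibbsProb_eq_div (E : Fin (D + 1) → ℝ) (β : ℝ) (N : ℕ) (A : Set (PlaneTree D)) :
    gibbsProb E β N A = partitionSum E β N A / partitionSum E β N Set.univ := by
  simp [gibbsProb, partitionSum]

theorem partitionSum_univ (E : Fin (D + 1) → ℝ) (β : ℝ) (N : ℕ) :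
    partitionSum E β N Set.univ = forestWeight (fun i => Real.exp (-β * E i)) N 1 := by
  have := partitionSum_cylinder E β N ∅ (fun _ => 0) (by simp)
  rw [card_hull] at this
  simpa [cylinder] using this

/-- The limiting probability of a cylinder. -/
noncomputable def cylinderLimit (E : Fin (D + 1) → ℝ) (β ρ σ : ℝ) (S : Finset (List (Fin D)))
    (d : List (Fin D) → Fin (D + 1)) : ℝ :=
  ((hull S d).card - S.card : ℕ) * (ρ ^ ((hull S d).card - S.card) / ρ) * σ ^ S.card *
    ∏ v ∈ S, Real.exp (-β * E (d v))

theorem tendsto_gibbsProb_cylinder (hD : 1 ≤ D) (E : Fin (D + 1) → ℝ) (β ρ : ℝ) (hρ : 0 < ρ)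
    (hρ_eq : ∑ i : Fin (D + 1), Real.exp (-β * E i) * ρ ^ (i : ℕ) =
      ∑ i : Fin (D + 1), ((i : ℕ) : ℝ) * Real.exp (-β * E i) * ρ ^ (i : ℕ))
    (S : Finset (List (Fin D))) (d : List (Fin D) → Fin (D + 1)) (hS : S ⊆ hull S d) :
    Tendsto (fun N => gibbsProb E β N (cylinder S d)) atTop
      (𝓝 (cylinderLimit E β ρ (ρ / ∑ i : Fin (D + 1), Real.exp (-β * E i) * ρ ^ (i : ℕ)) S d)) := by
  have h := (tendsto_forestWeight_div (fun i => Real.exp (-β * E i)) ρ hD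
    (fun i => Real.exp_pos _) hρ hρ_eq S.card ((hull S d).card - S.card)).mul_const
      (∏ v ∈ S, Real.exp (-β * E (d v)))
  refine h.congr' ?_
  filter_upwards [eventually_ge_atTop S.card] with N hN
  have := partitionSum_cylinder E β (N - S.card) S d hS
  rw [show S.card + (N - S.card) = N by omega] at this
  rw [gibbsProb_eq_div, partitionSum_univ, this]
  ring

theorem verts_trunc (n : ℕ) (T : PlaneTree D) (v : List (Fin D)) :
    v ∈ (T.trunc n).verts ↔ v ∈ T.verts ∧ v.length ≤ n := Iff.rfl

theorem trunc_trunc {m n : ℕ} (h : m ≤ n) (T : PlaneTree D) : (T.trunc n).trunc m = T.trunc m := by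
  ext v
  simp only [verts_trunc]
  constructor
  · rintro ⟨⟨h1, -⟩, h2⟩; exact ⟨h1, h2⟩
  · rintro ⟨h1, h2⟩; exact ⟨⟨h1, h2.trans h⟩, h2⟩

theorem deg_trunc {n : ℕ} (T : PlaneTree D) {v : List (Fin D)} (h : v.length < n) :
    (T.trunc n).deg v = T.deg v := by
  refine deg_eq_iff.2 fun i => ?_
  rw [verts_trunc, ← append_mem_iff]
  exact and_iff_left (by simpa using h)

theorem length_le_of_trunc_eq {n : ℕ} {T : PlaneTree D} (h : T.trunc n = T) {v : List (Fin D)}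
    (hv : v ∈ T.verts) : v.length ≤ n := by
  rw [← h] at hv; exact hv.2

theorem finite_setOf_trunc_eq (D n : ℕ) : {τ : PlaneTree D | τ.trunc n = τ}.Finite := by
  refine Set.Finite.of_finite_image (f := PlaneTree.verts)
    ((List.finite_length_lt (Fin D) (n + 1)).finite_subsets.subset ?_)
    (fun T _ T' _ h => PlaneTree.ext h)
  rintro _ ⟨T, hT, rfl⟩ v hv
  exact Nat.lt_succ_of_le (length_le_of_trunc_eq hT hv)

open Classical in
/-- The vertices of `τ` of height less than `n`. -/
noncomputable def inner (n : ℕ) (τ : PlaneTree D) : Finset (List (Fin D)) :=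
  (List.finite_length_lt (Fin D) n).toFinset.filter fun v => v ∈ τ.verts

open Classical in
/-- The vertices of `τ` of height `n`. -/
noncomputable def level (n : ℕ) (τ : PlaneTree D) : Finset (List (Fin D)) :=
  (List.finite_length_eq (Fin D) n).toFinset.filter fun v => v ∈ τ.verts

theorem mem_inner {n : ℕ} {τ : PlaneTree D} {v : List (Fin D)} :
    v ∈ inner n τ ↔ v ∈ τ.verts ∧ v.length < n := by
  simp [inner, and_comm]

theorem mem_level {n : ℕ} {τ : PlaneTree D} {v : List (Fin D)} :
    v ∈ level n τ ↔ v ∈ τ.verts ∧ v.length = n := by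
  simp [level, and_comm]

theorem levelSize_eq_card (n : ℕ) (τ : PlaneTree D) : levelSize n τ = (level n τ).card := by
  rw [levelSize, ← Set.ncard_coe_finset]
  congr 1; ext v; simp [mem_level]

theorem level_trunc {i n : ℕ} (h : i ≤ n) (T : PlaneTree D) : level i (T.trunc n) = level i T := by
  ext v
  simp only [mem_level, verts_trunc]
  constructor
  · rintro ⟨⟨h1, -⟩, h2⟩; exact ⟨h1, h2⟩
  · rintro ⟨h1, h2⟩; exact ⟨⟨h1, h2 ▸ h⟩, h2⟩

theorem levelSize_trunc {i n : ℕ} (h : i ≤ n) (T : PlaneTree D) :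
    levelSize i (T.trunc n) = levelSize i T := by
  simp only [levelSize_eq_card, level_trunc h]

theorem mem_hull_inner {n : ℕ} {τ : PlaneTree D} {v : List (Fin D)} :
    v ∈ hull (inner n τ) τ.deg ↔ v ∈ τ.verts ∧ v.length ≤ n := by
  rcases List.eq_nil_or_concat' v with rfl | ⟨u, i, rfl⟩
  · exact iff_of_true (nil_mem_hull _ _) ⟨τ.root_mem, Nat.zero_le _⟩
  · rw [append_mem_hull, mem_inner, ← append_mem_iff, List.length_append, List.length_singleton]
    exact ⟨fun h => ⟨h.2, h.1.2⟩, fun h => ⟨⟨mem_of_append_mem h.1, h.2⟩, h.1⟩⟩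

theorem inner_subset_hull (n : ℕ) (τ : PlaneTree D) : inner n τ ⊆ hull (inner n τ) τ.deg :=
  fun _ hv => mem_hull_inner.2 ⟨(mem_inner.1 hv).1, (mem_inner.1 hv).2.le⟩

theorem disjoint_inner_level (n : ℕ) (τ : PlaneTree D) : Disjoint (inner n τ) (level n τ) := by
  rw [Finset.disjoint_left]
  intro v h1 h2
  exact absurd (mem_level.1 h2).2 (mem_inner.1 h1).2.ne

theorem card_hull_inner (n : ℕ) (τ : PlaneTree D) :
    (hull (inner n τ) τ.deg).card = (inner n τ).card + levelSize n τ := by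
  classical
  rw [levelSize_eq_card, ← Finset.card_union_of_disjoint (disjoint_inner_level n τ)]
  congr 1; ext v
  rw [mem_hull_inner, Finset.mem_union, mem_inner, mem_level, ← and_or_left, le_iff_lt_or_eq]

/-- A neighbourhood of radius n is determined by the branching numbers strictly below height n;
level n consists of discovered, unexplored vertices. -/
theorem setOf_trunc_eq_cylinder {n : ℕ} {τ : PlaneTree D} (hτ : τ.trunc n = τ) :
    {T : PlaneTree D | T.trunc n = τ} = cylinder (inner n τ) τ.deg := by
  ext T
  constructor
  · rintro rfl v hv
    obtain ⟨h1, h2⟩ := mem_inner.1 hv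
    exact ⟨h1.1, (deg_trunc T h2).symm⟩
  · intro hT
    change T.trunc n = τ
    ext v
    rw [verts_trunc]
    constructor
    · rintro ⟨h1, h2⟩
      induction v using List.reverseRecOn with
      | nil => exact τ.root_mem
      | append_singleton v i ih =>
        have hlen : v.length < n := by simpa using h2
        have hv := ih (mem_of_append_mem h1) hlen.le
        rw [append_mem_iff, ← (hT v (mem_inner.2 ⟨hv, hlen⟩)).2, ← append_mem_iff]
        exact h1
    · intro hv
      exact ⟨hull_subset_verts hT (mem_hull_inner.2 ⟨hv, length_le_of_trunc_eq hτ hv⟩),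
        length_le_of_trunc_eq hτ hv⟩

/-- The event `B` is determined by the neighbourhood of the root of radius `n`. -/
def IsLocal (n : ℕ) (B : Set (PlaneTree D)) : Prop := ∀ T : PlaneTree D, T.trunc n ∈ B ↔ T ∈ B

theorem IsLocal.mono {m n : ℕ} (h : m ≤ n) {B : Set (PlaneTree D)} (hB : IsLocal m B) :
    IsLocal n B := fun T => by
  rw [← hB (T.trunc n), trunc_trunc h, hB]

theorem isLocal_setOf_mem_verts (v : List (Fin D)) :
    IsLocal v.length {T : PlaneTree D | v ∈ T.verts} := fun _ => and_iff_left le_rfl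

theorem isLocal_levelSize {i n : ℕ} (h : i ≤ n) (k : ℕ) :
    IsLocal n {T : PlaneTree D | levelSize i T = k} := fun T => by
  simp only [Set.mem_ofPred_eq, levelSize_trunc h]

theorem IsLocal.inter {n : ℕ} {A B : Set (PlaneTree D)} (hA : IsLocal n A) (hB : IsLocal n B) :
    IsLocal n (A ∩ B) := fun T => and_congr (hA T) (hB T)

open Classical in
/-- The trees of height at most `n` in the event `B`. -/
noncomputable def truncs (n : ℕ) (B : Set (PlaneTree D)) : Finset (PlaneTree D) :=
  (finite_setOf_trunc_eq D n).toFinset.filter fun τ => τ ∈ B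

theorem mem_truncs {n : ℕ} {B : Set (PlaneTree D)} {τ : PlaneTree D} :
    τ ∈ truncs n B ↔ τ.trunc n = τ ∧ τ ∈ B := by simp [truncs]

theorem IsLocal.eq_biUnion {n : ℕ} {B : Set (PlaneTree D)} (hB : IsLocal n B) :
    B = ⋃ τ ∈ truncs n B, {T : PlaneTree D | T.trunc n = τ} := by
  ext T
  simp only [Set.mem_iUnion, mem_truncs, Set.mem_ofPred_eq, exists_prop]
  constructor
  · exact fun h => ⟨T.trunc n, ⟨trunc_trunc le_rfl T, (hB T).2 h⟩, rfl⟩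
  · rintro ⟨τ, ⟨-, h⟩, rfl⟩; exact (hB T).1 h

theorem measurableSet_mem_verts (v : List (Fin D)) :
    MeasurableSet {T : PlaneTree D | v ∈ T.verts} := by
  have : Measurable (PlaneTree.verts : PlaneTree D → Set (List (Fin D))) := comap_measurable _
  exact measurableSet_setOfPred.2 (measurable_set_iff.1 this v)

theorem measurableSet_cylinder (S : Finset (List (Fin D))) (d : List (Fin D) → Fin (D + 1)) :
    MeasurableSet (cylinder S d) := by
  have : cylinder S d = ⋂ v ∈ S, {T : PlaneTree D | v ∈ T.verts} ∩
      ⋂ i : Fin D, {T : PlaneTree D | v ++ [i] ∈ T.verts ↔ (i : ℕ) < d v} := by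
    ext T
    simp only [cylinder, deg_eq_iff, Set.mem_iInter, Set.mem_ofPred_eq, Set.mem_inter_iff]
  rw [this]
  refine Finset.measurableSet_biInter _ fun v _ => (measurableSet_mem_verts v).inter
    (MeasurableSet.iInter fun i => ?_)
  by_cases h : (i : ℕ) < d v
  · simpa [h] using measurableSet_mem_verts (v ++ [i])
  · convert! (measurableSet_mem_verts (v ++ [i])).compl using 1
    ext T
    simp [h]

theorem measurableSet_trunc_eq (n : ℕ) (τ : PlaneTree D) :
    MeasurableSet {T : PlaneTree D | T.trunc n = τ} := by
  by_cases h : τ.trunc n = τ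
  · rw [setOf_trunc_eq_cylinder h]; exact measurableSet_cylinder _ _
  · convert MeasurableSet.empty
    refine Set.eq_empty_of_forall_notMem ?_
    rintro T rfl
    exact h (trunc_trunc le_rfl T)

theorem IsLocal.measurableSet {n : ℕ} {B : Set (PlaneTree D)} (hB : IsLocal n B) :
    MeasurableSet B := by
  rw [hB.eq_biUnion]
  exact Finset.measurableSet_biUnion _ fun τ _ => measurableSet_trunc_eq n τ

theorem pairwiseDisjoint_trunc_eq (n : ℕ) (s : Set (PlaneTree D)) :
    s.PairwiseDisjoint fun τ => {T : PlaneTree D | T.trunc n = τ} := by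
  intro τ _ τ' _ hne
  rw [Function.onFun, Set.disjoint_left]
  rintro T rfl h
  exact hne h

theorem IsLocal.measureReal_inter_eq_sum {n : ℕ} {B : Set (PlaneTree D)} (hB : IsLocal n B)
    (P : Measure (PlaneTree D)) [IsFiniteMeasure P] {C : Set (PlaneTree D)}
    (hC : MeasurableSet C) :
    P.real (B ∩ C) = ∑ τ ∈ truncs n B, P.real ({T : PlaneTree D | T.trunc n = τ} ∩ C) := by
  conv_lhs => rw [hB.eq_biUnion, Set.iUnion₂_inter]
  refine measureReal_biUnion_finset ?_ fun τ _ => (measurableSet_trunc_eq n τ).inter hC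
  exact (pairwiseDisjoint_trunc_eq n _).mono_on fun τ _ => Set.inter_subset_left

theorem IsLocal.measureReal_eq_sum {n : ℕ} {B : Set (PlaneTree D)} (hB : IsLocal n B)
    (P : Measure (PlaneTree D)) [IsFiniteMeasure P] :
    P.real B = ∑ τ ∈ truncs n B, P.real {T : PlaneTree D | T.trunc n = τ} := by
  simpa using hB.measureReal_inter_eq_sum P MeasurableSet.univ

theorem IsLocal.gibbsProb_eq_sum {n : ℕ} {B : Set (PlaneTree D)} (hB : IsLocal n B)
    (E : Fin (D + 1) → ℝ) (β : ℝ) (N : ℕ) :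
    gibbsProb E β N B = ∑ τ ∈ truncs n B, gibbsProb E β N {T | T.trunc n = τ} := by
  classical
  simp only [gibbsProb_eq_div]
  rw [← Finset.sum_div]
  congr 1
  simp only [partitionSum]
  rw [← Finset.sum_fiberwise_of_maps_to (g := fun T : PlaneTree D => T.trunc n) (t := truncs n B)]
  · refine Finset.sum_congr rfl fun τ hτ => Finset.sum_congr ?_ fun _ _ => rfl
    ext T
    simp only [Finset.mem_filter, and_assoc, and_congr_right_iff, Set.mem_ofPred_eq]
    refine fun _ => ⟨And.right, fun h => ⟨(hB T).1 ?_, h⟩⟩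
    rw [h]; exact (mem_truncs.1 hτ).2
  · intro T hT
    exact mem_truncs.2 ⟨trunc_trunc le_rfl T, (hB T).2 (Finset.mem_filter.1 hT).2⟩

theorem IsThermodynamicLimit.tendsto_of_isLocal {E : Fin (D + 1) → ℝ} {β : ℝ}
    {P : Measure (PlaneTree D)} (hP : IsThermodynamicLimit E β P) {n : ℕ} {B : Set (PlaneTree D)}
    (hB : IsLocal n B) : Tendsto (fun N => gibbsProb E β N B) atTop (𝓝 (P.real B)) := by
  have := hP.1
  simp_rw [hB.gibbsProb_eq_sum E β, hB.measureReal_eq_sum P]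
  exact tendsto_finsetSum _ fun τ _ => hP.2 n τ

theorem isLocal_cylinder (S : Finset (List (Fin D))) (d : List (Fin D) → Fin (D + 1)) {n : ℕ}
    (hn : ∀ v ∈ S, v.length < n) : IsLocal n (cylinder S d) := fun T => by
  refine forall₂_congr fun v hv => ?_
  rw [deg_trunc T (hn v hv), verts_trunc, and_iff_left (hn v hv).le]

theorem IsThermodynamicLimit.measureReal_cylinder (hD : 1 ≤ D) {E : Fin (D + 1) → ℝ} {β ρ : ℝ}
    (hρ : 0 < ρ) (hρ_eq : ∑ i : Fin (D + 1), Real.exp (-β * E i) * ρ ^ (i : ℕ) =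
      ∑ i : Fin (D + 1), ((i : ℕ) : ℝ) * Real.exp (-β * E i) * ρ ^ (i : ℕ))
    {P : Measure (PlaneTree D)} (hP : IsThermodynamicLimit E β P)
    {S : Finset (List (Fin D))} {d : List (Fin D) → Fin (D + 1)} (hS : S ⊆ hull S d) :
    P.real (cylinder S d) = cylinderLimit E β ρ
      (ρ / ∑ i : Fin (D + 1), Real.exp (-β * E i) * ρ ^ (i : ℕ)) S d :=
  tendsto_nhds_unique
    -- One extra level is needed to see the children of the highest vertices of S.
    (hP.tendsto_of_isLocal (isLocal_cylinder S d (n := S.sup List.length + 1)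
      fun _ hv => Nat.lt_succ_of_le (Finset.le_sup (f := List.length) hv)))
    (tendsto_gibbsProb_cylinder hD E β ρ hρ hρ_eq S d hS)

theorem generateFrom_isLocal :
    (inferInstance : MeasurableSpace (PlaneTree D)) =
      MeasurableSpace.generateFrom {B | ∃ n, IsLocal n B} := by
  refine le_antisymm ?_ (MeasurableSpace.generateFrom_le ?_)
  · have : @Measurable _ _ (MeasurableSpace.generateFrom {B | ∃ n, IsLocal n B}) _
        (PlaneTree.verts : PlaneTree D → Set (List (Fin D))) := by
      refine (@measurable_set_iff _ _ (_) _).2 fun v => ?_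
      refine (@measurableSet_setOfPred _ (_) _).1 ?_
      exact MeasurableSpace.measurableSet_generateFrom ⟨_, isLocal_setOf_mem_verts v⟩
    exact this.comap_le
  · rintro B ⟨n, hB⟩
    exact hB.measurableSet

/-- The limits fix the measure of every local event, and local events form a π-system generating the
σ-algebra. -/
theorem IsThermodynamicLimit.unique {E : Fin (D + 1) → ℝ} {β : ℝ} {P Q : Measure (PlaneTree D)}
    (hP : IsThermodynamicLimit E β P) (hQ : IsThermodynamicLimit E β Q) : P = Q := by
  have := hP.1
  have := hQ.1
  refine ext_of_generate_finite _ generateFrom_isLocal ?_ ?_ (by simp)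
  · rintro A ⟨m, hA⟩ B ⟨n, hB⟩ -
    exact ⟨max m n, (hA.mono (le_max_left _ _)).inter (hB.mono (le_max_right _ _))⟩
  · rintro B ⟨n, hB⟩
    exact (measureReal_eq_measureReal_iff).1
      (tendsto_nhds_unique (hP.tendsto_of_isLocal hB) (hQ.tendsto_of_isLocal hB))

end PlaneTree

/-! ### Existence of the limiting measure by compactness. -/

namespace PlaneTree

variable {D : ℕ}

/-- The largest plane tree all of whose nonempty words have the value `true` under `x`. -/
def ofCode (x : List (Fin D) → Bool) : PlaneTree D where
  verts := {v | ∀ (u : List (Fin D)) (i : Fin D), u ++ [i] <+: v → ∀ j ≤ i, x (u ++ [j]) = true}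
  root_mem u i h := by simp at h
  prefix_mem _ _ huv hv u i h := hv u i (h.trans huv)
  left_mem v i j hji hv u l h k hk := by
    rcases List.prefix_concat_iff.1 h with h | h
    · obtain ⟨rfl, h2⟩ := List.append_inj' h rfl
      obtain rfl : l = j := by simpa using h2
      exact hv u i (List.prefix_refl _) k (hk.trans hji)
    · exact hv u l (h.trans (List.prefix_append _ _)) k hk

open Classical in
/-- The indicator function of the vertex set. -/
noncomputable def code (T : PlaneTree D) (v : List (Fin D)) : Bool := decide (v ∈ T.verts)

theorem ofCode_code (T : PlaneTree D) : ofCode T.code = T := by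
  ext v
  constructor
  · intro h
    rcases List.eq_nil_or_concat' v with rfl | ⟨u, i, rfl⟩
    · exact T.root_mem
    · simpa [code] using h u i (List.prefix_refl _) i le_rfl
  · intro hv u i h j hj
    simpa [code] using T.left_mem u i j hj (T.prefix_mem _ _ h hv)

theorem append_mem_verts_ofCode {x : List (Fin D) → Bool} {v : List (Fin D)} {i : Fin D} :
    v ++ [i] ∈ (ofCode x).verts ↔ v ∈ (ofCode x).verts ∧ ∀ j ≤ i, x (v ++ [j]) = true := by
  refine ⟨fun h => ⟨mem_of_append_mem h, h v i (List.prefix_refl _)⟩, ?_⟩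
  rintro ⟨h1, h2⟩ u l h
  rcases List.prefix_concat_iff.1 h with h | h
  · obtain ⟨rfl, h3⟩ := List.append_inj' h rfl
    obtain rfl : l = i := by simpa using h3
    exact h2
  · exact h1 u l h

/-- Membership of v depends on finitely many coordinates: those of the prefixes of v and of their
left siblings. -/
theorem isClopen_setOf_mem_verts_ofCode (v : List (Fin D)) :
    IsClopen {x : List (Fin D) → Bool | v ∈ (ofCode x).verts} := by
  induction v using List.reverseRecOn with
  | nil =>
    convert! isClopen_univ
    exact Set.eq_univ_of_forall fun x => (ofCode x).root_mem
  | append_singleton v i ih =>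
    have : {x : List (Fin D) → Bool | v ++ [i] ∈ (ofCode x).verts} =
        {x | v ∈ (ofCode x).verts} ∩ ⋂ j ∈ Finset.Iic i, {x | x (v ++ [j]) = true} := by
      ext x
      simp only [append_mem_verts_ofCode, Set.mem_ofPred_eq, Set.mem_inter_iff, Set.mem_iInter,
        Finset.mem_Iic]
    rw [this]
    refine ih.inter (isClopen_biInter_finset fun j _ => ?_)
    exact (isClopen_discrete ({true} : Set Bool)).preimage (continuous_apply (v ++ [j]))

theorem isClopen_preimage_ofCode_trunc_eq (n : ℕ) (τ : PlaneTree D) :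
    IsClopen (ofCode ⁻¹' {T : PlaneTree D | T.trunc n = τ}) := by
  by_cases hτ : τ.trunc n = τ
  · have : ofCode ⁻¹' {T : PlaneTree D | T.trunc n = τ} =
        ⋂ v ∈ (List.finite_length_le (Fin D) n).toFinset,
          {x : List (Fin D) → Bool | v ∈ (ofCode x).verts ↔ v ∈ τ.verts} := by
      ext x
      simp only [Set.mem_preimage, Set.mem_ofPred_eq, Set.mem_iInter, Set.Finite.mem_toFinset]
      constructor
      · rintro rfl v hv
        exact (and_iff_left hv).symm
      · intro h
        ext v
        rw [verts_trunc]
        constructor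
        · rintro ⟨h1, h2⟩; exact (h v h2).1 h1
        · intro hv
          have := length_le_of_trunc_eq hτ hv
          exact ⟨(h v this).2 hv, this⟩
    rw [this]
    refine isClopen_biInter_finset fun v _ => ?_
    by_cases h : v ∈ τ.verts
    · simpa [h] using! isClopen_setOf_mem_verts_ofCode v
    · convert! (isClopen_setOf_mem_verts_ofCode v).compl using 1
      ext x
      simp [h]
  · convert! isClopen_empty
    refine Set.eq_empty_of_forall_notMem ?_
    rintro x rfl
    exact hτ (trunc_trunc le_rfl _)

theorem measurable_ofCode : Measurable (ofCode : (List (Fin D) → Bool) → PlaneTree D) := by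
  refine measurable_comap_iff.2 (measurable_set_iff.2 fun v => ?_)
  exact measurableSet_setOfPred.1 (isClopen_setOf_mem_verts_ofCode v).isClosed.measurableSet

/-- The Gibbs distribution on the codes of the trees on `N` vertices. -/
noncomputable def gibbsCodeMeasure (E : Fin (D + 1) → ℝ) (β : ℝ) (N : ℕ) :
    Measure (List (Fin D) → Bool) :=
  ∑ T ∈ (finite_ofSize D N).toFinset,
    ENNReal.ofReal (Real.exp (-β * T.energy E) / partitionSum E β N Set.univ) • Measure.dirac T.code

theorem partitionSum_nonneg (E : Fin (D + 1) → ℝ) (β : ℝ) (N : ℕ) (A : Set (PlaneTree D)) :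
    0 ≤ partitionSum E β N A := Finset.sum_nonneg fun _ _ => (Real.exp_pos _).le

theorem gibbsProb_nonneg (E : Fin (D + 1) → ℝ) (β : ℝ) (N : ℕ) (A : Set (PlaneTree D)) :
    0 ≤ gibbsProb E β N A := by
  rw [gibbsProb_eq_div]
  exact div_nonneg (partitionSum_nonneg _ _ _ _) (partitionSum_nonneg _ _ _ _)

theorem gibbsCodeMeasure_apply (E : Fin (D + 1) → ℝ) (β : ℝ) (N : ℕ)
    {A : Set (List (Fin D) → Bool)} (hA : MeasurableSet A) :
    gibbsCodeMeasure E β N A = ENNReal.ofReal (gibbsProb E β N (code ⁻¹' A)) := by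
  classical
  rw [gibbsProb_eq_div, partitionSum, Finset.sum_div, ENNReal.ofReal_sum_of_nonneg
    fun _ _ => div_nonneg (Real.exp_pos _).le (partitionSum_nonneg _ _ _ _), Finset.sum_filter,
    gibbsCodeMeasure, Measure.finsetSum_apply]
  refine Finset.sum_congr rfl fun T _ => ?_
  rw [Measure.smul_apply, Measure.dirac_apply' _ hA, smul_eq_mul, Set.indicator_apply]
  simp only [Set.mem_preimage, Pi.one_apply, mul_ite, mul_one, mul_zero]

theorem isProbabilityMeasure_gibbsCodeMeasure {E : Fin (D + 1) → ℝ} {β : ℝ} {N : ℕ}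
    (h : 0 < partitionSum E β N Set.univ) : IsProbabilityMeasure (gibbsCodeMeasure E β N) :=
  ⟨by rw [gibbsCodeMeasure_apply E β N MeasurableSet.univ, gibbsProb_eq_div, Set.preimage_univ,
    div_self h.ne', ENNReal.ofReal_one]⟩

open Classical in
/-- If the probabilities of all finite neighbourhoods of the root converge, then there is a limiting
random tree: the space of codes is compact. -/
theorem exists_isThermodynamicLimit {E : Fin (D + 1) → ℝ} {β : ℝ}
    (hpos : ∀ᶠ N in atTop, 0 < partitionSum (D := D) E β N Set.univ)
    (hlim : ∀ (n : ℕ) (τ : PlaneTree D),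
      ∃ L, Tendsto (fun N => gibbsProb E β N {T | T.trunc n = τ}) atTop (𝓝 L)) :
    ∃ P : Measure (PlaneTree D), IsThermodynamicLimit E β P := by
  let m : ℕ → ProbabilityMeasure (List (Fin D) → Bool) := fun N =>
    if h : 0 < partitionSum (D := D) E β N Set.univ then
      ⟨gibbsCodeMeasure E β N, isProbabilityMeasure_gibbsCodeMeasure h⟩
    -- An arbitrary default for the N whose partition sum is not positive; by `hpos` these do not
    -- affect the limit.
    else ⟨Measure.dirac fun _ => true, inferInstance⟩
  let U : Ultrafilter ℕ := Ultrafilter.of atTop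
  have hU : (U : Filter ℕ) ≤ atTop := Ultrafilter.of_le _
  -- Probability measures on a compact space form a compact space, so an ultrafilter limit exists.
  -- Clopen events have no boundary, so weak convergence gives convergence of their probabilities;
  -- since the full limits exist by `hlim`, they agree with those along the ultrafilter.
  obtain ⟨μ, -, hμ⟩ := isCompact_univ.ultrafilter_le_nhds (U.map m) (by simp)
  have hμ : Tendsto m U (𝓝 μ) := hμ
  have hprob : IsProbabilityMeasure ((μ : Measure (List (Fin D) → Bool)).map ofCode) :=
    Measure.isProbabilityMeasure_map measurable_ofCode.aemeasurable
  refine ⟨(μ : Measure (List (Fin D) → Bool)).map ofCode, hprob, fun n τ => ?_⟩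
  obtain ⟨L, hL⟩ := hlim n τ
  have hclopen := isClopen_preimage_ofCode_trunc_eq n τ
  have h1 := ProbabilityMeasure.tendsto_measure_of_isClopen_of_tendsto hμ hclopen
  have h2 : Tendsto (fun N => gibbsProb E β N {T | T.trunc n = τ}) U
      (𝓝 ((μ : Measure (List (Fin D) → Bool)).real (ofCode ⁻¹' {T | T.trunc n = τ}))) := by
    have h3 := (NNReal.continuous_coe.tendsto _).comp h1
    refine (h3.congr' ?_)
    filter_upwards [hU hpos] with N hN
    have hm : m N = ⟨gibbsCodeMeasure E β N, isProbabilityMeasure_gibbsCodeMeasure hN⟩ := dif_pos hN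
    rw [Function.comp_apply, hm]
    change (gibbsCodeMeasure E β N).real _ = _
    rw [measureReal_def, gibbsCodeMeasure_apply E β N hclopen.isClosed.measurableSet,
      ENNReal.toReal_ofReal (gibbsProb_nonneg _ _ _ _), ← Set.preimage_comp]
    congr 1
    ext T
    simp [ofCode_code]
  rw [map_measureReal_apply measurable_ofCode (measurableSet_trunc_eq n τ),
    tendsto_nhds_unique h2 (hL.mono_left hU)]
  exact hL

theorem existsUnique_isThermodynamicLimit (hD : 1 ≤ D) (E : Fin (D + 1) → ℝ) (β ρ : ℝ) (hρ : 0 < ρ)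
    (hρ_eq : ∑ i : Fin (D + 1), Real.exp (-β * E i) * ρ ^ (i : ℕ) =
      ∑ i : Fin (D + 1), ((i : ℕ) : ℝ) * Real.exp (-β * E i) * ρ ^ (i : ℕ)) :
    ∃! P : Measure (PlaneTree D), IsThermodynamicLimit E β P := by
  obtain ⟨P, hP⟩ : ∃ P : Measure (PlaneTree D), IsThermodynamicLimit E β P := by
    refine exists_isThermodynamicLimit ?_ fun n τ => ?_
    · simp_rw [partitionSum_univ]
      exact eventually_forestWeight_one_pos _ ρ hD (fun i => Real.exp_pos _) hρ hρ_eq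
    · by_cases h : τ.trunc n = τ
      · rw [setOf_trunc_eq_cylinder h]
        exact ⟨_, tendsto_gibbsProb_cylinder hD E β ρ hρ hρ_eq _ _ (inner_subset_hull n τ)⟩
      · refine ⟨0, ?_⟩
        have : {T : PlaneTree D | T.trunc n = τ} = ∅ := by
          refine Set.eq_empty_of_forall_notMem ?_
          rintro T rfl
          exact h (trunc_trunc le_rfl T)
        simp [this, gibbsProb]
  exact ⟨P, hP, fun Q hQ => IsThermodynamicLimit.unique hQ hP⟩

end PlaneTree

/-! ### The Markov property of the level sizes. -/

namespace PlaneTree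

variable {D : ℕ}

theorem levelSize_succ (n : ℕ) (T : PlaneTree D) :
    levelSize (n + 1) T = ∑ v ∈ level n T, (T.deg v : ℕ) := by
  classical
  have h : level (n + 1) T = (level n T).biUnion fun v => children v (T.deg v) := by
    ext v
    simp only [mem_level, Finset.mem_biUnion, mem_children]
    constructor
    · rintro ⟨h1, h2⟩
      rcases List.eq_nil_or_concat' v with rfl | ⟨u, i, rfl⟩
      · simp at h2
      · exact ⟨u, ⟨mem_of_append_mem h1, by simpa using h2⟩, i, append_mem_iff.1 h1, rfl⟩
    · rintro ⟨u, ⟨-, h2⟩, i, h3, rfl⟩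
      exact ⟨append_mem_iff.2 h3, by simp [h2]⟩
  rw [levelSize_eq_card, h, Finset.card_biUnion (pairwiseDisjoint_children _ _)]
  simp_rw [card_children]

open Classical in
/-- The branching numbers `d`, changed to `e` on `L`. -/
noncomputable def overrideOn (d : List (Fin D) → Fin (D + 1)) (L : Finset (List (Fin D)))
    (e : L → Fin (D + 1)) (v : List (Fin D)) : Fin (D + 1) :=
  if h : v ∈ L then e ⟨v, h⟩ else d v

theorem overrideOn_of_mem (d : List (Fin D) → Fin (D + 1)) {L : Finset (List (Fin D))}
    (e : L → Fin (D + 1)) (v : L) : overrideOn d L e v = e v := dif_pos v.2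

theorem overrideOn_of_disjoint (d : List (Fin D) → Fin (D + 1)) {S L : Finset (List (Fin D))}
    (h : Disjoint S L) (e : L → Fin (D + 1)) {v : List (Fin D)} (hv : v ∈ S) :
    overrideOn d L e v = d v := dif_neg (Finset.disjoint_left.1 h hv)

open Classical in
/-- The law of the next level size, given the neighbourhood of the root of radius `n`, as a disjoint
union of cylinders. -/
theorem setOf_trunc_eq_inter_levelSize {n : ℕ} {τ : PlaneTree D} (hτ : τ.trunc n = τ) (k' : ℕ) :
    {T : PlaneTree D | T.trunc n = τ} ∩ {T | levelSize (n + 1) T = k'} =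
      ⋃ e ∈ (Finset.univ.filter fun e : level n τ → Fin (D + 1) => ∑ v, (e v : ℕ) = k'),
        cylinder (inner n τ ∪ level n τ) (overrideOn τ.deg (level n τ) e) := by
  have hdisj := disjoint_inner_level n τ
  ext T
  simp only [Set.mem_inter_iff, Set.mem_ofPred_eq, Set.mem_iUnion, Finset.mem_filter,
    Finset.mem_univ, true_and, exists_prop]
  constructor
  · rintro ⟨h1, h2⟩
    have hl : level n T = level n τ := by rw [← h1, level_trunc le_rfl]
    rw [levelSize_succ, hl, ← Finset.sum_coe_sort] at h2
    refine ⟨fun v => T.deg v, h2, fun v hv => ?_⟩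
    rcases Finset.mem_union.1 hv with hv | hv
    · rw [overrideOn_of_disjoint _ hdisj _ hv]
      have : T ∈ cylinder (inner n τ) τ.deg := by rw [← setOf_trunc_eq_cylinder hτ]; exact h1
      exact this v hv
    · refine ⟨?_, (overrideOn_of_mem _ (fun v : level n τ => T.deg v) ⟨v, hv⟩).symm⟩
      rw [← hl] at hv
      exact (mem_level.1 hv).1
  · rintro ⟨e, he, hT⟩
    have h1 : T ∈ {T : PlaneTree D | T.trunc n = τ} := by
      rw [setOf_trunc_eq_cylinder hτ]
      intro v hv
      rw [← overrideOn_of_disjoint τ.deg hdisj e hv]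
      exact hT v (Finset.mem_union_left _ hv)
    have h1 : T.trunc n = τ := h1
    refine ⟨h1, ?_⟩
    have hl : level n T = level n τ := by rw [← h1, level_trunc le_rfl]
    rw [levelSize_succ, hl, ← he, ← Finset.sum_coe_sort]
    refine Finset.sum_congr rfl fun v _ => ?_
    rw [(hT v (Finset.mem_union_right _ v.2)).2, overrideOn_of_mem]

open Classical in
theorem cylinderLimit_override (E : Fin (D + 1) → ℝ) (β ρ σ : ℝ) (n : ℕ) (τ : PlaneTree D)
    (e : level n τ → Fin (D + 1)) :
    inner n τ ∪ level n τ ⊆ hull (inner n τ ∪ level n τ) (overrideOn τ.deg (level n τ) e) ∧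
    cylinderLimit E β ρ σ (inner n τ ∪ level n τ) (overrideOn τ.deg (level n τ) e) =
      (∑ v, (e v : ℕ) : ℕ) * (ρ ^ (∑ v, (e v : ℕ)) / ρ) *
        σ ^ ((inner n τ).card + levelSize n τ) *
        ((∏ v ∈ inner n τ, Real.exp (-β * E (τ.deg v))) * Real.exp (-β * ∑ v, E (e v))) := by
  have hdisj := disjoint_inner_level n τ
  set d := overrideOn τ.deg (level n τ) e with hd
  have hdS : ∀ v ∈ inner n τ, d v = τ.deg v := fun v hv => overrideOn_of_disjoint _ hdisj e hv
  have hcard : (inner n τ ∪ level n τ).card = (inner n τ).card + levelSize n τ := by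
    rw [Finset.card_union_of_disjoint hdisj, levelSize_eq_card]
  have hhull : (hull (inner n τ ∪ level n τ) d).card =
      (inner n τ).card + levelSize n τ + ∑ v, (e v : ℕ) := by
    rw [← card_hull_inner, card_hull, card_hull, Finset.sum_union hdisj, ← add_assoc,
      Finset.sum_congr rfl fun v hv => by rw [hdS v hv], ← Finset.sum_coe_sort (level n τ)]
    congr 1
    exact Finset.sum_congr rfl fun v _ => by rw [hd, overrideOn_of_mem]
  constructor
  · intro v hv
    have hv' : v ∈ τ.verts ∧ v.length ≤ n := by
      rcases Finset.mem_union.1 hv with h | h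
      · exact ⟨(mem_inner.1 h).1, (mem_inner.1 h).2.le⟩
      · exact ⟨(mem_level.1 h).1, (mem_level.1 h).2.le⟩
    rw [← mem_hull_inner] at hv'
    rcases List.eq_nil_or_concat' v with rfl | ⟨u, i, rfl⟩
    · exact nil_mem_hull _ _
    · obtain ⟨h1, h2⟩ := append_mem_hull.1 hv'
      exact append_mem_hull.2 ⟨Finset.mem_union_left _ h1, by rwa [hdS u h1]⟩
  · rw [cylinderLimit, hhull, hcard, Nat.add_sub_cancel_left, Finset.prod_union hdisj,
      Finset.prod_congr rfl fun v hv => by rw [hdS v hv], ← Finset.prod_coe_sort (level n τ),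
      Finset.mul_sum, Real.exp_sum]
    congr 2
    exact Finset.prod_congr rfl fun v _ => by rw [hd, overrideOn_of_mem]

theorem pairwiseDisjoint_cylinder_overrideOn (S L : Finset (List (Fin D)))
    (d : List (Fin D) → Fin (D + 1)) (hL : L ⊆ S) (s : Set (L → Fin (D + 1))) :
    s.PairwiseDisjoint fun e => cylinder S (overrideOn d L e) := by
  intro e _ e' _ hne
  rw [Function.onFun, Set.disjoint_left]
  intro T h h'
  refine hne (funext fun v => ?_)
  rw [← overrideOn_of_mem d e v, ← overrideOn_of_mem d e' v, ← (h v (hL v.2)).2,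
    ← (h' v (hL v.2)).2]

/-- Revealing level n, of size k, replaces k ρ^k by k' ρ^k' in the limiting probability, adds σ^k
and multiplies by the weights of the new branching numbers. The weight of the inner vertices is a
common factor, so the ratio depends on τ only through k. -/
theorem IsThermodynamicLimit.measureReal_trunc_inter_levelSize (hD : 1 ≤ D)
    {E : Fin (D + 1) → ℝ} {β ρ : ℝ} (hρ : 0 < ρ)
    (hρ_eq : ∑ i : Fin (D + 1), Real.exp (-β * E i) * ρ ^ (i : ℕ) =
      ∑ i : Fin (D + 1), ((i : ℕ) : ℝ) * Real.exp (-β * E i) * ρ ^ (i : ℕ))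
    {P : Measure (PlaneTree D)} (hP : IsThermodynamicLimit E β P)
    {n : ℕ} {τ : PlaneTree D} (hτ : τ.trunc n = τ) (k' : ℕ) :
    P.real ({T : PlaneTree D | T.trunc n = τ} ∩ {T | levelSize (n + 1) T = k'}) =
      P.real {T : PlaneTree D | T.trunc n = τ} * levelTransition E β ρ
        (ρ / ∑ i : Fin (D + 1), Real.exp (-β * E i) * ρ ^ (i : ℕ)) (levelSize n τ) k' := by
  classical
  have := hP.1
  set σ := ρ / ∑ i : Fin (D + 1), Real.exp (-β * E i) * ρ ^ (i : ℕ)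
  have h0 : P.real {T : PlaneTree D | T.trunc n = τ} =
      (levelSize n τ : ℕ) * (ρ ^ levelSize n τ / ρ) * σ ^ (inner n τ).card *
        ∏ v ∈ inner n τ, Real.exp (-β * E (τ.deg v)) := by
    rw [setOf_trunc_eq_cylinder hτ, hP.measureReal_cylinder hD hρ hρ_eq (inner_subset_hull n τ),
      cylinderLimit, card_hull_inner, Nat.add_sub_cancel_left]
  -- Neighbourhoods with empty level n are null because of the factor k: the limiting tree is almost
  -- surely infinite. This disposes of the division by k.
  rcases Nat.eq_zero_or_pos (levelSize n τ) with hk | hk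
  · have h1 : P.real {T : PlaneTree D | T.trunc n = τ} = 0 := by rw [h0, hk]; simp
    rw [h1, zero_mul]
    exact measureReal_mono_null Set.inter_subset_left h1
  have hsum : P.real ({T : PlaneTree D | T.trunc n = τ} ∩ {T | levelSize (n + 1) T = k'}) =
      ∑ e : level n τ → Fin (D + 1) with ∑ v, (e v : ℕ) = k',
        k' * (ρ ^ k' / ρ) * σ ^ ((inner n τ).card + levelSize n τ) *
        ((∏ v ∈ inner n τ, Real.exp (-β * E (τ.deg v))) * Real.exp (-β * ∑ v, E (e v))) := by
    rw [setOf_trunc_eq_inter_levelSize hτ, measureReal_biUnion_finset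
      (pairwiseDisjoint_cylinder_overrideOn _ _ _ Finset.subset_union_right _)
      fun e _ => measurableSet_cylinder _ _]
    refine Finset.sum_congr rfl fun e he => ?_
    obtain ⟨h1, h2⟩ := cylinderLimit_override E β ρ σ n τ e
    rw [hP.measureReal_cylinder hD hρ hρ_eq h1, h2, (Finset.mem_filter.1 he).2]
  have hre : ∑ e : level n τ → Fin (D + 1) with ∑ v, (e v : ℕ) = k', Real.exp (-β * ∑ v, E (e v)) =
      ∑ i : Fin (levelSize n τ) → Fin (D + 1) with ∑ j, (i j : ℕ) = k',
        Real.exp (-β * ∑ j, E (i j)) := by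
    let φ : level n τ ≃ Fin (levelSize n τ) :=
      (level n τ).equivFin.trans (finCongr (levelSize_eq_card n τ).symm)
    rw [Finset.sum_filter, Finset.sum_filter]
    refine Fintype.sum_equiv (φ.arrowCongr (Equiv.refl _)) _ _ fun e => ?_
    simp only [Equiv.arrowCongr_apply, Equiv.coe_refl, Function.comp_apply, id_eq]
    rw [φ.symm.sum_comp (fun v => (e v : ℕ)), φ.symm.sum_comp (fun v => E (e v))]
  rw [hsum, h0, levelTransition, ← hre, ← Finset.mul_sum, ← Finset.mul_sum, zpow_sub₀ hρ.ne',
    zpow_natCast, zpow_natCast, pow_add]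
  have hk' : (levelSize n τ : ℝ) ≠ 0 := by positivity
  field_simp

/-- Summing over neighbourhoods keeps the factor, since it is the same for all of them once the
level size is fixed. The whole past of level sizes and the present one alone are both events of this
kind. -/
theorem IsThermodynamicLimit.measureReal_inter_levelSize (hD : 1 ≤ D)
    {E : Fin (D + 1) → ℝ} {β ρ : ℝ} (hρ : 0 < ρ)
    (hρ_eq : ∑ i : Fin (D + 1), Real.exp (-β * E i) * ρ ^ (i : ℕ) =
      ∑ i : Fin (D + 1), ((i : ℕ) : ℝ) * Real.exp (-β * E i) * ρ ^ (i : ℕ))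
    {P : Measure (PlaneTree D)} (hP : IsThermodynamicLimit E β P)
    {n k : ℕ} {A : Set (PlaneTree D)} (hA : IsLocal n A) (hAk : ∀ T ∈ A, levelSize n T = k)
    (k' : ℕ) :
    P.real (A ∩ {T | levelSize (n + 1) T = k'}) = P.real A * levelTransition E β ρ
        (ρ / ∑ i : Fin (D + 1), Real.exp (-β * E i) * ρ ^ (i : ℕ)) k k' := by
  have := hP.1
  rw [hA.measureReal_inter_eq_sum P (isLocal_levelSize le_rfl k').measurableSet,
    hA.measureReal_eq_sum P, Finset.sum_mul]
  refine Finset.sum_congr rfl fun τ hτ => ?_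
  obtain ⟨h1, h2⟩ := mem_truncs.1 hτ
  rw [hP.measureReal_trunc_inter_levelSize hD hρ hρ_eq h1, hAk τ h2]

theorem IsThermodynamicLimit.isMarkovChainWith (hD : 1 ≤ D)
    {E : Fin (D + 1) → ℝ} {β ρ : ℝ} (hρ : 0 < ρ)
    (hρ_eq : ∑ i : Fin (D + 1), Real.exp (-β * E i) * ρ ^ (i : ℕ) =
      ∑ i : Fin (D + 1), ((i : ℕ) : ℝ) * Real.exp (-β * E i) * ρ ^ (i : ℕ))
    {P : Measure (PlaneTree D)} (hP : IsThermodynamicLimit E β P) :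
    IsMarkovChainWith P (fun n T => levelSize n T) (levelTransition E β ρ
      (ρ / ∑ i : Fin (D + 1), Real.exp (-β * E i) * ρ ^ (i : ℕ))) := by
  have := hP.1
  have key : ∀ {n k : ℕ} {A : Set (PlaneTree D)}, IsLocal n A → (∀ T ∈ A, levelSize n T = k) →
      P A ≠ 0 → ∀ k' : ℕ, (P[|A]).real {T | levelSize (n + 1) T = k'} = levelTransition E β ρ
        (ρ / ∑ i : Fin (D + 1), Real.exp (-β * E i) * ρ ^ (i : ℕ)) k k' := by
    intro n k A hA hAk h0 k'
    have hne : P.real A ≠ 0 := by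
      rw [measureReal_def]; exact ENNReal.toReal_ne_zero.2 ⟨h0, measure_ne_top _ _⟩
    rw [measureReal_def, cond_apply hA.measurableSet, ENNReal.toReal_mul, ENNReal.toReal_inv,
      ← measureReal_def, ← measureReal_def, hP.measureReal_inter_levelSize hD hρ hρ_eq hA hAk,
      inv_mul_cancel_left₀ hne]
  refine ⟨fun n => ?_, fun n y h0 k' => ?_, fun n k h0 k' => ?_⟩
  · exact measurable_to_countable' fun k => (isLocal_levelSize (le_refl n) k).measurableSet
  · refine key (A := {T | ∀ i ≤ n, levelSize i T = y i}) (fun T => ?_) (fun T hT => hT n le_rfl)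
      h0 k'
    exact forall₂_congr fun i hi => by rw [levelSize_trunc hi]
  · exact key (isLocal_levelSize le_rfl k) (fun _ hT => hT) h0 k'

end PlaneTree

/-! ### The main theorem. -/

theorem theorem9 (D : ℕ) (hD : 2 ≤ D) (E : Fin (D + 1) → ℝ) (β : ℝ)
    (p : Fin (D + 1) → ℝ) (hp : p ∈ criticalVectors D)
    (hmin : IsMinOn (freeEnergy E β) (criticalVectors D) p)
    (ρ : ℝ) (hρ : 0 < ρ)
    (hρ_eq : ∑ i : Fin (D + 1), Real.exp (-β * E i) * ρ ^ (i : ℕ) =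
      ∑ i : Fin (D + 1), ((i : ℕ) : ℝ) * Real.exp (-β * E i) * ρ ^ (i : ℕ))
    (σ : ℝ) (hσ : σ = Real.exp (freeEnergy E β p)) :
    (∃! P : Measure (PlaneTree D), PlaneTree.IsThermodynamicLimit E β P) ∧
    ∀ P : Measure (PlaneTree D), PlaneTree.IsThermodynamicLimit E β P →
      IsMarkovChainWith P (fun n T => PlaneTree.levelSize n T) (levelTransition E β ρ σ) := by
  have hD1 : 1 ≤ D := by omega
  -- The minimizer enters only here, through the value σ = ρ/F.
  rw [hσ, exp_freeEnergy_eq E β p hp hmin ρ hρ hρ_eq]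
  exact ⟨PlaneTree.existsUnique_isThermodynamicLimit hD1 E β ρ hρ hρ_eq,
    fun P hP => hP.isMarkovChainWith hD1 hρ hρ_eq⟩
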